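/- Let $\widehat{\mathbf M}=(\hat{\mathbb X},\hat{\mathbb U},\mathbb Y,\hat x_0,\hat{\mathbf t},\hat h)$ and $\mathbf M=(\mathbb X,\mathbb U,\mathbb Y,x_0,\mathbf t,h)$ be general Markov decision processes: Polish state spaces and input spaces, a common metric output space $\mathbb Y$, initial states, Borel stochastic transition kernels and measurable output maps. For a probability measure $\nu$ on inputs write $\mathbf t(\cdot\mid x,\nu)=\int\mathbf t(\cdot\mid x,u)\,\nu(du)$. Let $\delta\ge 0$ and suppose $\widehat{\mathbf M}\preceq^{\delta}_{0}\mathbf M$, i.e. there are a universally measurable interface function $\mathcal U_v:\hat{\mathbb U}\times\hat{\mathbb X}\times\mathbb X\to\mathcal P(\mathbb U)$, a measurable relation $\mathcal R\subseteq\hat{\mathbb X}\times\mathbb X$ with $(\hat x_0,x_0)\in\mathcal R$, and a Borel stochastic kernel $\mathbb W_{\mathbf t}(\cdot\mid\hat u,\hat x,x)$ on $\hat{\mathbb X}\times\mathbb X$ such that for all $(\hat x,x)\in\mathcal R$: $\hat h(\hat x)=h(x)$, and for all $\hat u\in\hat{\mathbb U}$ the measure $\mathbb W_{\mathbf t}(\cdot\mid\hat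 u,\hat x,x)$ has marginals $\hat{\mathbf t}(\cdot\mid\hat x,\hat u)$ and $\mathbf t(\cdot\mid x,\mathcal U_v(\hat u,\hat x,x))$ and gives $\mathcal R$ mass at least $1-\delta$. Let $\psi$ be an scLTL formula over a finite set $AP$ of atomic propositions, $\mathsf L:\mathbb Y\to 2^{AP}$ a measurable labelling, and $\mathcal A_\psi=(Q,q_0,2^{AP},F,\tau)$ a finite deterministic automaton such that an infinite word satisfies $\psi$ if and only if some finite prefix of it drives $\mathcal A_\psi$ from $q_0$ into $F$. For a universally measurable $\mu:\hat{\mathbb X}\times Q\to\mathcal P(\hat{\mathbb U})$ and $V:\hat{\mathbb X}\times Q\to[0,1]$ put $$\mathbf T^{\mu}_{\delta}(V)(\hat x,q)=\min\Big(1,\max\Big(0,\int_{\hat{\mathbb X}}\max\{\mathbf 1_F(q'),V(\hat x',q')\}\,\hat{\mathbf t}(d\hat x'\mid\hat x,\mu(\hat x,q))-\delta\Big)\Big),\qquad q'=\tau(q,\mathsf L(\hat h(\hat x'))),$$ $\mathbf T^{*}_{\delta}=\sup_\mu\mathbf T^{\mu}_{\delta}$, $V^{\mu}_\infty=\lim_{l}(\mathbf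 T^{\mu}_\delta)^l(0)$, $V^*_\infty=\lim_{l}(\mathbf T^{*}_\delta)^l(0)$, and $$\mathcal S^*_\delta=\max\{\mathbf 1_F(\bar q_0),V^*_\infty(\hat x_0,\bar q_0)\},\qquad \bar q_0=\tau(q_0,\mathsf L(\hat h(\hat x_0))).$$ Let $\mu^*$ be an optimal $(0,\delta)$-robust policy, i.e. a universally measurable map that attains the supremum: $\mathbf T^{\mu^*}_\delta(V^*_\infty)=\mathbf T^*_\delta(V^*_\infty)$; if $\delta=0$, assume in addition that $V^{\mu^*}_\infty=V^*_\infty$. Let $\mathbf C$ be the control strategy for $\mathbf M$ (a universally measurable strategy with memory) that refines $\mu^*$: upon observing the state $x_t$ of $\mathbf M$ at time $t$, it sets $\hat x_t=\hat x_0$ if $t=0$ and draws $\hat x_t$ from the conditional law $\mathbb W_{\mathbf t}(d\hat x_t\mid x_t;\hat u_{t-1},\hat x_{t-1},x_{t-1})$ of the first component given the second if $t\ge1$; it updates $q_t=\tau(q_{t-1},\mathsf L(h(x_t)))$, with $q_{-1}=q_0$ the initial location of $\mathcal A_\psi$; it draws $\hat u_t\sim\mu^*(\hat x_t,q_t)$;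 and it applies an input drawn from $\mathcal U_v(\hat u_t,\hat x_t,x_t)$. Then the controlled process $\mathbf C\times\mathbf M$ satisfies $$\mathbb P_{\mathbf C\times\mathbf M}(\boldsymbol\omega\models\psi)\ \ge\ \mathcal S^*_\delta,\qquad \boldsymbol\omega=\{\mathsf L(h(x_t))\}_{t\ge0}.$$ -/

import Mathlib

open MeasureTheory ProbabilityTheory Filter Topology
open scoped ENNReal NNReal

/-! ### Universal measurability -/

/-- `f` is universally measurable: for every finite measure on its domain it is measurable up to
a null set. -/
def UnivMeasurable {α β : Type*} [MeasurableSpace α] [MeasurableSpace β] (f : α → β) : Prop :=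
  ∀ ν : Measure α, IsFiniteMeasure ν → AEMeasurable f ν

/-! ### General Markov decision processes

The measurable structure of a Polish space is expressed by `StandardBorelSpace`
(a measurable space that is the Borel space of some Polish topology). -/

/-- A general Markov decision process with states `X`, inputs `U` and outputs `Y`. -/
structure GMDP (X U Y : Type*) [MeasurableSpace X] [MeasurableSpace U] [MeasurableSpace Y] where
  init : X
  trans : Kernel (X × U) X
  markov : IsMarkovKernel trans
  out : X → Y
  measurable_out : Measurable out

attribute [instance] GMDP.markov

/-- `t(· | x, ν)`: the law of the next state when the input is drawn from `ν`. -/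
noncomputable def GMDP.next {X U Y : Type*} [MeasurableSpace X] [MeasurableSpace U]
    [MeasurableSpace Y] (M : GMDP X U Y) (x : X) (ν : ProbabilityMeasure U) : Measure X :=
  (ν : Measure U).bind fun u => M.trans (x, u)

/-- A decision rule of a Markov policy: a universally measurable map from states to probability
distributions over inputs. The policy that applies it at all times is a stationary Markov
policy. -/
structure Policy (X U : Type*) [MeasurableSpace X] [MeasurableSpace U] where
  toFun : X → ProbabilityMeasure U
  univMeasurable : UnivMeasurable toFun

/-- A control strategy for a gMDP with states `X` and inputs `U`: a memory space with an initial
memory, a memory update that reads the state of the gMDP, and an output that is a distribution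
over the inputs of the gMDP. -/
structure ControlStrategy.{v, w₁, w₂} (X : Type w₁) (U : Type w₂) [MeasurableSpace X]
    [MeasurableSpace U] where
  Mem : Type v
  measurableSpace : MeasurableSpace Mem
  standardBorel : StandardBorelSpace Mem
  init : Mem
  trans : Mem × X → ProbabilityMeasure Mem
  univMeasurable_trans : UnivMeasurable trans
  out : Mem → ProbabilityMeasure U
  univMeasurable_out : UnivMeasurable out

attribute [instance] ControlStrategy.measurableSpace ControlStrategy.standardBorel

/-- One transition of the controlled gMDP `C × M` from `z = (x, c)`: the memory is updated to
`c' ∼ t_C(· | c, x)`, the input `u ∼ h_C(c')` is drawn, and then `x' ∼ t(· | x, u)`. -/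
noncomputable def stepLaw {X U Y : Type*} [MeasurableSpace X] [MeasurableSpace U]
    [MeasurableSpace Y] (M : GMDP X U Y) (C : ControlStrategy X U) (z : X × C.Mem) :
    Measure (X × C.Mem) :=
  (C.trans (z.2, z.1) : Measure C.Mem).bind fun c' =>
    (M.next z.1 (C.out c')).map fun x' => (x', c')

/-- `P` is the law of the infinite execution `(x_t, c_t)` of the controlled gMDP `C × M`: it starts
at the initial states, and given the history `(ω 0, …, ω n)`, which is `Preorder.frestrictLe n ω`,
the conditional law of `ω (n + 1)` is `stepLaw M C (ω n)`. -/
structure IsExecutionLaw {X U Y : Type*} [MeasurableSpace X] [MeasurableSpace U]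
    [MeasurableSpace Y] (M : GMDP X U Y) (C : ControlStrategy X U)
    (P : Measure (ℕ → X × C.Mem)) : Prop where
  prob : IsProbabilityMeasure P
  init : P.map (fun ω => ω 0) = Measure.dirac (M.init, C.init)
  step : ∀ (n : ℕ) (A : Set (Finset.Iic n → X × C.Mem)) (B : Set (X × C.Mem)),
    MeasurableSet A → MeasurableSet B →
      P {ω | Preorder.frestrictLe n ω ∈ A ∧ ω (n + 1) ∈ B} =
        ∫⁻ ω in {ω | Preorder.frestrictLe n ω ∈ A}, stepLaw M C (ω n) B ∂P

/-! ### Syntactically co-safe linear temporal logic -/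

/-- scLTL formulas over the atomic propositions `AP`. -/
inductive ScLTL (AP : Type*) where
  | atom (p : AP) : ScLTL AP
  | negAtom (p : AP) : ScLTL AP
  | and (φ ψ : ScLTL AP) : ScLTL AP
  | or (φ ψ : ScLTL AP) : ScLTL AP
  | next (φ : ScLTL AP) : ScLTL AP
  | until (φ ψ : ScLTL AP) : ScLTL AP

/-- `ψ.Sat w`: the infinite word `w` over the alphabet `2^AP` satisfies `ψ`. -/
def ScLTL.Sat {AP : Type*} : ScLTL AP → (ℕ → Set AP) → Prop
  | .atom p, w => p ∈ w 0
  | .negAtom p, w => p ∉ w 0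
  | .and φ ψ, w => φ.Sat w ∧ ψ.Sat w
  | .or φ ψ, w => φ.Sat w ∨ ψ.Sat w
  | .next φ, w => φ.Sat fun t => w (1 + t)
  | .until φ ψ, w =>
      ∃ i, ψ.Sat (fun t => w (i + t)) ∧ ∀ j < i, φ.Sat fun t => w (j + t)

/-- The infinite word `w` is accepted by the automaton: some finite prefix of `w` (possibly the
empty one) leads from the initial location to an accepting location. -/
def AcceptsWord {AP Q : Type*} (A : DFA (Set AP) Q) (w : ℕ → Set AP) : Prop :=
  ∃ n : ℕ, (List.range n).map w ∈ A.accepts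

/-- `A` is an automaton for `ψ`. -/
def Recognizes {AP Q : Type*} (A : DFA (Set AP) Q) (ψ : ScLTL AP) : Prop :=
  ∀ w : ℕ → Set AP, ψ.Sat w ↔ AcceptsWord A w

/-- The controlled gMDP `C × M` satisfies `ψ` with probability at least `p`, where `L` labels
outputs with sets of atomic propositions. -/
def SatisfiesWithProbAtLeast {AP X U Y : Type*} [MeasurableSpace X] [MeasurableSpace U]
    [MeasurableSpace Y] (M : GMDP X U Y) (C : ControlStrategy X U) (L : Y → Set AP)
    (ψ : ScLTL AP) (p : ℝ≥0∞) : Prop :=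
  ∃ P : Measure (ℕ → X × C.Mem), IsExecutionLaw M C P ∧
    p ≤ P {ω | ψ.Sat fun t => L (M.out (ω t).1)}

/-! ### Approximate simulation relations -/

/-- `W` witnesses that `(Δ, Θ)` belongs to the `δ`-lifting of the relation `R`. -/
def IsLifting {Xh X : Type*} [MeasurableSpace Xh] [MeasurableSpace X] (δ : ℝ≥0)
    (R : Set (Xh × X)) (Δ : Measure Xh) (Θ : Measure X) (W : Measure (Xh × X)) : Prop :=
  (∀ A, MeasurableSet A → W (A ×ˢ Set.univ) = Δ A) ∧
    (∀ A, MeasurableSet A → W (Set.univ ×ˢ A) = Θ A) ∧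
    1 - (δ : ℝ≥0∞) ≤ W R

/-- An `(ε, δ)`-stochastic simulation of `Mh` by `M`, given by its interface function, its relation
and its lifted kernel. -/
structure StochSim {Xh Uh X U Y : Type*} [MeasurableSpace Xh] [MeasurableSpace Uh]
    [MeasurableSpace X] [MeasurableSpace U] [MetricSpace Y] [MeasurableSpace Y]
    (Mh : GMDP Xh Uh Y) (M : GMDP X U Y) (ε δ : ℝ≥0) where
  interface : Uh × Xh × X → ProbabilityMeasure U
  univMeasurable_interface : UnivMeasurable interface
  rel : Set (Xh × X)
  measurableSet_rel : MeasurableSet rel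
  lift : Kernel (Uh × Xh × X) (Xh × X)
  markov : IsMarkovKernel lift
  init_mem : (Mh.init, M.init) ∈ rel
  dist_out_le : ∀ xh x, (xh, x) ∈ rel → dist (Mh.out xh) (M.out x) ≤ ε
  isLifting : ∀ xh x, (xh, x) ∈ rel → ∀ uh : Uh,
    IsLifting δ rel (Mh.trans (xh, uh)) (M.next x (interface (uh, xh, x))) (lift (uh, xh, x))

attribute [instance] StochSim.markov

/-! ### Product with an automaton and robust dynamic programming -/

theorem measurable_dfaUpdate {AP X U Y Q : Type*} [Finite AP] [Finite Q] [MeasurableSpace X]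
    [MeasurableSpace U] [MeasurableSpace Y] [MeasurableSpace Q] [DiscreteMeasurableSpace Q]
    (M : GMDP X U Y) {L : Y → Set AP} (hL : Measurable L) (A : DFA (Set AP) Q) :
    Measurable fun p : X × Q => A.step p.2 (L (M.out p.1)) := by
  have h : Measurable fun p : Q × Set AP => A.step p.1 p.2 := Measurable.of_discrete
  exact h.comp (measurable_snd.prodMk ((hL.comp M.measurable_out).comp measurable_fst))

/-- The product gMDP `M ⊗ A`: from `(x, q)` under input `u` it moves to `(x', τ(q, L(h(x'))))`
with `x' ∼ t(· | x, u)`; its initial state is `(x₀, τ(q₀, L(h(x₀))))`. -/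
noncomputable def GMDP.prodDFA {AP X U Y Q : Type*} [Finite AP] [Finite Q] [MeasurableSpace X]
    [MeasurableSpace U] [MeasurableSpace Y] [MeasurableSpace Q] [DiscreteMeasurableSpace Q]
    (M : GMDP X U Y) (L : Y → Set AP) (hL : Measurable L) (A : DFA (Set AP) Q) :
    GMDP (X × Q) U Y where
  init := (M.init, A.step A.start (L (M.out M.init)))
  trans :=
    ((M.trans.comap (fun z : (X × Q) × U => (z.1.1, z.2)) (by fun_prop)) ×ₖ
        Kernel.deterministic (fun z : (X × Q) × U => z.1.2) (by fun_prop)).map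
      fun p => (p.1, A.step p.2 (L (M.out p.1)))
  markov := Kernel.IsMarkovKernel.map _ (measurable_fst.prodMk (measurable_dfaUpdate M hL A))
  out := fun z => M.out z.1
  measurable_out := M.measurable_out.comp measurable_fst

section Operators

variable {S U Y Q : Type*} [MeasurableSpace S] [MeasurableSpace Q] [MeasurableSpace U]
  [MeasurableSpace Y]

/-- The Bellman operator `T^μ` on a gMDP with state space `S × Q` and accepting locations `F`. -/
noncomputable def bellman (N : GMDP (S × Q) U Y) (F : Set Q) (μ : Policy (S × Q) U)
    (V : S × Q → ℝ≥0∞) (z : S × Q) : ℝ≥0∞ :=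
  ∫⁻ z', max (F.indicator 1 z'.2) (V z') ∂(N.next z (μ.toFun z))

/-- The `δ`-robust operator `T_δ^μ(V) = min(1, max(0, T^μ(V) - δ))`; the subtraction of extended
nonnegative reals is truncated at `0`. -/
noncomputable def robust (N : GMDP (S × Q) U Y) (F : Set Q) (δ : ℝ≥0) (μ : Policy (S × Q) U)
    (V : S × Q → ℝ≥0∞) (z : S × Q) : ℝ≥0∞ :=
  min 1 (bellman N F μ V z - δ)

/-- The optimal `δ`-robust operator `T_δ^*`. -/
noncomputable def optRobust (N : GMDP (S × Q) U Y) (F : Set Q) (δ : ℝ≥0)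
    (V : S × Q → ℝ≥0∞) (z : S × Q) : ℝ≥0∞ :=
  ⨆ μ : Policy (S × Q) U, robust N F δ μ V z

/-- `V_∞^μ`, the (increasing) pointwise limit of the iterates of `T_δ^μ` from `0`. -/
noncomputable def robustValue (N : GMDP (S × Q) U Y) (F : Set Q) (δ : ℝ≥0)
    (μ : Policy (S × Q) U) (z : S × Q) : ℝ≥0∞ :=
  ⨆ l : ℕ, (robust N F δ μ)^[l] 0 z

/-- `V_∞^*`, the (increasing) pointwise limit of the iterates of `T_δ^*` from `0`. -/
noncomputable def optRobustValue (N : GMDP (S × Q) U Y) (F : Set Q) (δ : ℝ≥0)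
    (z : S × Q) : ℝ≥0∞ :=
  ⨆ l : ℕ, (optRobust N F δ)^[l] 0 z

theorem robust_mono (N : GMDP (S × Q) U Y) (F : Set Q) (δ : ℝ≥0) (μ : Policy (S × Q) U) :
    Monotone (robust N F δ μ) := fun _ _ h _ =>
  min_le_min_left _ (tsub_le_tsub_right (lintegral_mono fun z' => max_le_max_left _ (h z')) _)

theorem optRobust_mono (N : GMDP (S × Q) U Y) (F : Set Q) (δ : ℝ≥0) :
    Monotone (optRobust N F δ) := fun _ _ h z =>
  iSup_mono fun μ => robust_mono N F δ μ h z

theorem tendsto_robustValue (N : GMDP (S × Q) U Y) (F : Set Q) (δ : ℝ≥0) (μ : Policy (S × Q) U)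
    (z : S × Q) :
    Tendsto (fun l => (robust N F δ μ)^[l] 0 z) atTop (𝓝 (robustValue N F δ μ z)) :=
  tendsto_atTop_iSup fun _ _ hab =>
    (robust_mono N F δ μ).monotone_iterate_of_le_map (fun _ => zero_le) hab z

theorem tendsto_optRobustValue (N : GMDP (S × Q) U Y) (F : Set Q) (δ : ℝ≥0) (z : S × Q) :
    Tendsto (fun l => (optRobust N F δ)^[l] 0 z) atTop (𝓝 (optRobustValue N F δ z)) :=
  tendsto_atTop_iSup fun _ _ hab =>
    (optRobust_mono N F δ).monotone_iterate_of_le_map (fun _ => zero_le) hab z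

/-- `μ ∈ arg sup_μ T_δ^μ(V_∞^*)`. -/
def IsArgSup (N : GMDP (S × Q) U Y) (F : Set Q) (δ : ℝ≥0) (μ : Policy (S × Q) U) : Prop :=
  ∀ z, robust N F δ μ (optRobustValue N F δ) z = optRobust N F δ (optRobustValue N F δ) z

/-- The optimal `(0, δ)`-robust satisfaction probability `S_δ^*` of the product gMDP `N`. -/
noncomputable def optRobustSat (N : GMDP (S × Q) U Y) (F : Set Q) (δ : ℝ≥0) : ℝ≥0∞ :=
  max (F.indicator 1 N.init.2) (optRobustValue N F δ N.init)

end Operators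

/-! ### Universal measurability of one step, and uniqueness of the execution law -/

theorem UnivMeasurable.bind {Z P W : Type*} [MeasurableSpace Z] [MeasurableSpace P]
    [MeasurableSpace W] {κ : Z → ProbabilityMeasure P} (hκ : UnivMeasurable κ)
    {F : Z × P → ProbabilityMeasure W} (hF : UnivMeasurable F) :
    ∃ G : Z → ProbabilityMeasure W, UnivMeasurable G ∧
      ∀ z, (G z : Measure W) = (κ z : Measure P).bind fun p => (F (z, p) : Measure W) := by
  have hFz : ∀ z, AEMeasurable (fun p => (F (z, p) : Measure W)) (κ z : Measure P) := by
    intro z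
    have h1 := hF ((κ z : Measure P).map (Prod.mk z)) inferInstance
    exact measurable_subtype_coe.comp_aemeasurable (h1.comp_measurable measurable_prodMk_left)
  have hp : ∀ z, IsProbabilityMeasure
      ((κ z : Measure P).bind fun p => (F (z, p) : Measure W)) := by
    intro z
    constructor
    rw [Measure.bind_apply MeasurableSet.univ (hFz z)]
    simp
  refine ⟨fun z => ⟨_, hp z⟩, ?_, fun z => rfl⟩
  intro ν hν
  have hκν := hκ ν hν
  let κ' : Kernel Z P := ⟨fun z => ((AEMeasurable.mk κ hκν z : ProbabilityMeasure P) : Measure P),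
    measurable_subtype_coe.comp hκν.measurable_mk⟩
  have : IsMarkovKernel κ' := ⟨fun z => (hκν.mk κ z).2⟩
  have hFρ := hF (ν ⊗ₘ κ') inferInstance
  let F' : Kernel (Z × P) W := ⟨fun y => ((AEMeasurable.mk F hFρ y : ProbabilityMeasure W) : Measure W),
    measurable_subtype_coe.comp hFρ.measurable_mk⟩
  have : IsMarkovKernel F' := ⟨fun y => (hFρ.mk F y).2⟩
  have hm : Measurable fun z => (κ' z).bind fun p => F' (z, p) := by
    refine Measure.measurable_of_measurable_coe _ fun s hs => ?_
    have : ∀ z, ((κ' z).bind fun p => F' (z, p)) s = ∫⁻ p, F' (z, p) s ∂κ' z := fun z =>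
      Measure.bind_apply hs (F'.measurable.comp measurable_prodMk_left).aemeasurable
    simp_rw [this]
    exact (F'.measurable_coe hs).lintegral_kernel_prod_right'
  have hm' : ∀ z, IsProbabilityMeasure ((κ' z).bind fun p => F' (z, p)) := by
    intro z
    constructor
    refine (Measure.bind_apply MeasurableSet.univ
      (F'.measurable.comp measurable_prodMk_left).aemeasurable).trans ?_
    simp
  refine ⟨fun z => ⟨_, hm' z⟩, hm.subtype_mk, ?_⟩
  have hae := Measure.ae_ae_of_ae_compProd hFρ.ae_eq_mk
  filter_upwards [hκν.ae_eq_mk, hae] with z hz1 hz2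
  apply Subtype.ext
  change (κ z : Measure P).bind _ = (κ' z).bind _
  have : (κ z : Measure P) = κ' z := congrArg Subtype.val hz1
  rw [this]
  refine Measure.bind_congr_right ?_
  filter_upwards [hz2] with p hp2
  exact congrArg Subtype.val hp2

theorem UnivMeasurable.of_measurable {α β : Type*} [MeasurableSpace α] [MeasurableSpace β]
    {f : α → β} (hf : Measurable f) : UnivMeasurable f := fun _ _ => hf.aemeasurable

theorem UnivMeasurable.comp_measurable {α β γ : Type*} [MeasurableSpace α] [MeasurableSpace β]
    [MeasurableSpace γ] {g : β → γ} (hg : UnivMeasurable g) {f : α → β} (hf : Measurable f) :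
    UnivMeasurable fun a => g (f a) := fun ν _ =>
  (hg (ν.map f) inferInstance).comp_measurable hf

theorem UnivMeasurable.map {Z P W : Type*} [MeasurableSpace Z] [MeasurableSpace P]
    [MeasurableSpace W] {κ : Z → ProbabilityMeasure P} (hκ : UnivMeasurable κ)
    {f : Z × P → W} (hf : Measurable f) :
    ∃ G : Z → ProbabilityMeasure W, UnivMeasurable G ∧
      ∀ z, (G z : Measure W) = (κ z : Measure P).map fun p => f (z, p) := by
  obtain ⟨G, hG, hG'⟩ := hκ.bind (F := fun y => ⟨Measure.dirac (f y), inferInstance⟩)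
    (UnivMeasurable.of_measurable (Measure.measurable_dirac.comp hf).subtype_mk)
  exact ⟨G, hG, fun z => (hG' z).trans
    (Measure.bind_dirac_eq_map _ (hf.comp measurable_prodMk_left))⟩

theorem UnivMeasurable.next {X U Y Z : Type*} [MeasurableSpace X] [MeasurableSpace U]
    [MeasurableSpace Y] [MeasurableSpace Z] (M : GMDP X U Y) {ν : Z → ProbabilityMeasure U}
    (hν : UnivMeasurable ν) {x : Z → X} (hx : Measurable x) :
    ∃ G : Z → ProbabilityMeasure X, UnivMeasurable G ∧
      ∀ z, (G z : Measure X) = M.next (x z) (ν z) :=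
  hν.bind (F := fun y => ⟨M.trans (x y.1, y.2), inferInstance⟩)
    (UnivMeasurable.of_measurable (M.trans.measurable.comp
      ((hx.comp measurable_fst).prodMk measurable_snd)).subtype_mk)

/-- The one-step law of a controlled gMDP is a universally measurable stochastic kernel. -/
theorem exists_stepLaw {X U Y : Type*} [MeasurableSpace X] [MeasurableSpace U]
    [MeasurableSpace Y] (M : GMDP X U Y) (C : ControlStrategy X U) :
    ∃ G : X × C.Mem → ProbabilityMeasure (X × C.Mem), UnivMeasurable G ∧
      ∀ z, (G z : Measure (X × C.Mem)) = stepLaw M C z := by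
  obtain ⟨G₁, hG₁, hG₁'⟩ := UnivMeasurable.next M (Z := (X × C.Mem) × C.Mem)
    (C.univMeasurable_out.comp_measurable measurable_snd) (x := fun y => y.1.1) (by fun_prop)
  obtain ⟨G₂, hG₂, hG₂'⟩ := hG₁.map (f := fun y => (y.2, y.1.2)) (by fun_prop)
  obtain ⟨G₃, hG₃, hG₃'⟩ :=
    (C.univMeasurable_trans.comp_measurable (f := fun z : X × C.Mem => (z.2, z.1))
      (by fun_prop)).bind hG₂
  refine ⟨G₃, hG₃, fun z => ?_⟩
  rw [hG₃' z, stepLaw]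
  simp only [hG₂', hG₁']

/-- The execution law of a controlled gMDP is unique. -/
theorem IsExecutionLaw.unique {X U Y : Type*} [MeasurableSpace X] [MeasurableSpace U]
    [MeasurableSpace Y] {M : GMDP X U Y} {C : ControlStrategy X U}
    {P P' : Measure (ℕ → X × C.Mem)} (h : IsExecutionLaw M C P) (h' : IsExecutionLaw M C P') :
    P = P' := by
  have := h.prob
  have := h'.prob
  obtain ⟨G, hG, hG'⟩ := exists_stepLaw M C
  have hrec : ∀ n : ℕ, P.map (Preorder.frestrictLe n) = P'.map (Preorder.frestrictLe n) := by
    intro n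
    induction n with
    | zero =>
      let e : X × C.Mem → (Finset.Iic 0 → X × C.Mem) := fun z _ => z
      have he : Measurable e := measurable_pi_lambda _ fun _ => measurable_id
      have h0 : (Preorder.frestrictLe 0 : (ℕ → X × C.Mem) → _) = e ∘ fun ω => ω 0 := by
        funext ω i
        have hi : (i : ℕ) = 0 := Nat.le_zero.1 (Finset.mem_Iic.1 i.2)
        simp [e, Preorder.frestrictLe_apply, hi]
      rw [h0, ← Measure.map_map he (measurable_pi_apply 0),
        ← Measure.map_map he (measurable_pi_apply 0), h.init, h'.init]
    | succ n ih =>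
      let e : (Finset.Iic n → X × C.Mem) × (X × C.Mem) → (Finset.Iic (n + 1) → X × C.Mem) :=
        fun y i => if hi : (i : ℕ) ≤ n then y.1 ⟨i, Finset.mem_Iic.2 hi⟩ else y.2
      have he : Measurable e := by
        refine measurable_pi_lambda _ fun i => ?_
        by_cases hi : (i : ℕ) ≤ n
        · simp only [e, hi, dite_true]; fun_prop
        · simp only [e, hi, dite_false]; fun_prop
      have hpair : Measurable fun ω : ℕ → X × C.Mem =>
          ((Preorder.frestrictLe n ω : Finset.Iic n → X × C.Mem), ω (n + 1)) :=
        (Preorder.measurable_frestrictLe n).prodMk (measurable_pi_apply _)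
      have h0 : (Preorder.frestrictLe (n + 1) : (ℕ → X × C.Mem) → _) =
          e ∘ fun ω => (Preorder.frestrictLe n ω, ω (n + 1)) := by
        funext ω i
        by_cases hi : (i : ℕ) ≤ n
        · simp [e, hi, Preorder.frestrictLe_apply]
        · have : (i : ℕ) = n + 1 := by have := Finset.mem_Iic.1 i.2; omega
          simp [e, Preorder.frestrictLe_apply, this]
      rw [h0, ← Measure.map_map he hpair, ← Measure.map_map he hpair]
      congr 1
      have key : ∀ R : Measure (ℕ → X × C.Mem), IsExecutionLaw M C R →
          ∀ A B, MeasurableSet A → MeasurableSet B →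
          R.map (fun ω => ((Preorder.frestrictLe n ω : Finset.Iic n → X × C.Mem), ω (n + 1)))
            (A ×ˢ B) = ∫⁻ y in A, stepLaw M C (y ⟨n, Finset.mem_Iic.2 le_rfl⟩) B
              ∂(R.map (Preorder.frestrictLe n)) := by
        intro R hR A B hA hB
        have := hR.prob
        rw [Measure.map_apply hpair (hA.prod hB)]
        refine (hR.step n A B hA hB).trans ?_
        have hm : Measurable (Preorder.frestrictLe n : (ℕ → X × C.Mem) → _) :=
          Preorder.measurable_frestrictLe n
        rw [Measure.restrict_map hm hA, lintegral_map' _ hm.aemeasurable]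
        · rfl
        · simp only [← hG']
          have hc : Measurable fun y : Finset.Iic n → X × C.Mem =>
            y ⟨n, Finset.mem_Iic.2 le_rfl⟩ := measurable_pi_apply _
          exact ((Measure.measurable_coe hB).comp measurable_subtype_coe).comp_aemeasurable
            (hG.comp_measurable hc _ inferInstance)
      refine Measure.ext_prod fun {A B} hA hB => ?_
      rw [key P h A B hA hB, key P' h' A B hA hB, ih]
  have hproj : IsProjectiveLimit P fun I => P'.map I.restrict := by
    intro I
    have hI := I.subset_Iic_sup_id
    have hr : ∀ R : Measure (ℕ → X × C.Mem), R.map I.restrict =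
        (R.map (Preorder.frestrictLe (I.sup id))).map (Finset.restrict₂ (π := fun _ => X × C.Mem) hI) := by
      intro R
      rw [Measure.map_map (Finset.measurable_restrict₂ hI) (Preorder.measurable_frestrictLe _)]
      rfl
    exact (hr P).trans ((congrArg _ (hrec _)).trans (hr P').symm)
  exact hproj.unique fun I => rfl

/-! ### Refinement of a policy for the abstract model to a control strategy -/

/-- The memory `(û, x̂, x, q, b)` of the refined strategy: the last abstract input, abstract state,
concrete state and automaton location; `b` is `false` before the first update. -/
abbrev RefMem (Xh Uh X Q : Type*) := (Uh × Xh × X) × Q × Bool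

theorem measurableSet_started {Xh Uh X Q : Type*} [MeasurableSpace Xh] [MeasurableSpace Uh]
    [MeasurableSpace X] [MeasurableSpace Q] :
    MeasurableSet {z : RefMem Xh Uh X Q × X | z.1.2.2 = true} :=
  (measurable_snd.comp (measurable_snd.comp measurable_fst)) (measurableSet_singleton true)

section Refinement

variable {AP Xh Uh X U Y Q : Type*} [Finite AP] [Finite Q] [MeasurableSpace Q]
  [DiscreteMeasurableSpace Q] [MeasurableSpace Xh] [StandardBorelSpace Xh]
  [MeasurableSpace Uh] [MeasurableSpace X] [StandardBorelSpace X]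
  [MeasurableSpace U] [MetricSpace Y] [MeasurableSpace Y]
  {Mh : GMDP Xh Uh Y} {M : GMDP X U Y} {ε δ : ℝ≥0}

/-- The conditional law `W_t(dx̂' | x', û, x̂, x)` of the next abstract state given the next
concrete state, as a kernel from `((û, x̂, x), x')`. -/
noncomputable def StochSim.cond (sim : StochSim Mh M ε δ) :
    Kernel ((Uh × Xh × X) × X) Xh :=
  have : Nonempty Xh := ⟨Mh.init⟩
  (sim.lift.map Prod.swap).condKernel

instance (sim : StochSim Mh M ε δ) : IsMarkovKernel sim.cond := by
  have : Nonempty Xh := ⟨Mh.init⟩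
  have : IsMarkovKernel (sim.lift.map Prod.swap) := Kernel.IsMarkovKernel.map _ measurable_swap
  unfold StochSim.cond
  infer_instance

/-- Update of the coupled states: from memory `c` and the observed concrete state `x'`, the law of
`(x̂', q', x')`. At the first update `x̂'` is the initial abstract state; afterwards `x̂'` is drawn from
the conditional law. The location `q'` follows the label of `x'`. -/
noncomputable def refUpdate (sim : StochSim Mh M ε δ) (L : Y → Set AP) (hL : Measurable L)
    (A : DFA (Set AP) Q) : Kernel (RefMem Xh Uh X Q × X) ((Xh × Q) × X) :=
  Kernel.piecewise measurableSet_started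
    (((sim.cond.comap (fun z => (z.1.1, z.2)) (by fun_prop)) ×ₖ
      Kernel.deterministic (fun z => (z.1.2.1, z.2)) (by fun_prop)).map
        fun p => ((p.1, A.step p.2.1 (L (M.out p.2.2))), p.2.2))
    (Kernel.deterministic (fun z => ((Mh.init, A.step A.start (L (M.out z.2))), z.2))
      (((measurable_const.prodMk ((Measurable.of_discrete (f := A.step A.start)).comp
        (hL.comp (M.measurable_out.comp measurable_snd))))).prodMk measurable_snd))

instance (sim : StochSim Mh M ε δ) (L : Y → Set AP) (hL : Measurable L) (A : DFA (Set AP) Q) :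
    IsMarkovKernel (refUpdate sim L hL A) := by
  have hm : Measurable fun p : Xh × Q × X =>
      ((p.1, A.step p.2.1 (L (M.out p.2.2))), p.2.2) :=
    (measurable_fst.prodMk ((measurable_dfaUpdate M hL A).comp
      (measurable_snd.comp measurable_snd |>.prodMk (measurable_fst.comp measurable_snd)))).prodMk
      (measurable_snd.comp measurable_snd)
  have := Kernel.IsMarkovKernel.map (((sim.cond.comap
      (fun z : RefMem Xh Uh X Q × X => (z.1.1, z.2)) (by fun_prop)) ×ₖ
      Kernel.deterministic (fun z : RefMem Xh Uh X Q × X => (z.1.2.1, z.2)) (by fun_prop))) hm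
  unfold refUpdate
  infer_instance

/-- The memory update of the refined strategy: update the coupled states to `(x̂', q', x')`, draw
`û' ∼ μ(x̂', q')`, and store `(û', x̂', x', q')`. -/
noncomputable def refTrans (sim : StochSim Mh M ε δ) (L : Y → Set AP) (hL : Measurable L)
    (A : DFA (Set AP) Q) (μ : Policy (Xh × Q) Uh) (z : RefMem Xh Uh X Q × X) :
    Measure (RefMem Xh Uh X Q) :=
  (refUpdate sim L hL A z).bind fun p =>
    (μ.toFun p.1 : Measure Uh).map fun uh => ((uh, p.1.1, p.2), p.1.2, true)

theorem exists_refTrans (sim : StochSim Mh M ε δ) (L : Y → Set AP) (hL : Measurable L)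
    (A : DFA (Set AP) Q) (μ : Policy (Xh × Q) Uh) :
    ∃ G : RefMem Xh Uh X Q × X → ProbabilityMeasure (RefMem Xh Uh X Q), UnivMeasurable G ∧
      ∀ z, (G z : Measure (RefMem Xh Uh X Q)) = refTrans sim L hL A μ z := by
  obtain ⟨G₁, hG₁, hG₁'⟩ := (μ.univMeasurable.comp_measurable
    (f := fun y : (RefMem Xh Uh X Q × X) × ((Xh × Q) × X) => y.2.1) (by fun_prop)).map
    (f := fun y => (((y.2, y.1.2.1.1, y.1.2.2), y.1.2.1.2, true) : RefMem Xh Uh X Q))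
    (by fun_prop)
  obtain ⟨G₂, hG₂, hG₂'⟩ := UnivMeasurable.bind
    (κ := fun z => (⟨refUpdate sim L hL A z, inferInstance⟩ : ProbabilityMeasure _))
    (UnivMeasurable.of_measurable (refUpdate sim L hL A).measurable.subtype_mk) hG₁
  refine ⟨G₂, hG₂, fun z => ?_⟩
  rw [hG₂' z]
  simp only [hG₁']
  rfl

theorem isProbabilityMeasure_refTrans (sim : StochSim Mh M ε δ) (L : Y → Set AP)
    (hL : Measurable L) (A : DFA (Set AP) Q) (μ : Policy (Xh × Q) Uh)
    (z : RefMem Xh Uh X Q × X) : IsProbabilityMeasure (refTrans sim L hL A μ z) := by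
  obtain ⟨G, -, hG⟩ := exists_refTrans sim L hL A μ
  exact hG z ▸ (G z).2

/-- The control strategy for `M` obtained by refining the stationary policy `μ` on `Mh ⊗ A`: it
tracks the abstract state through the conditional lifted kernel and the location of `A` through the
labels of `M`, draws the abstract input `û` from `μ`, and outputs the interface `U_v(û, x̂, x)`. The
abstract input in the initial memory is arbitrary and is never used. -/
noncomputable def refinedStrategy [StandardBorelSpace Uh] (sim : StochSim Mh M ε δ)
    (L : Y → Set AP) (hL : Measurable L) (A : DFA (Set AP) Q) (μ : Policy (Xh × Q) Uh) :
    ControlStrategy X U where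
  Mem := RefMem Xh Uh X Q
  measurableSpace := inferInstance
  standardBorel := inferInstance
  init := ((((μ.toFun (Mh.init, A.start)).nonempty).some, Mh.init, M.init), A.start, false)
  trans := fun z => ⟨refTrans sim L hL A μ z, isProbabilityMeasure_refTrans sim L hL A μ z⟩
  univMeasurable_trans := by
    obtain ⟨G, hG, hG'⟩ := exists_refTrans sim L hL A μ
    have h : (fun z => (⟨refTrans sim L hL A μ z, isProbabilityMeasure_refTrans sim L hL A μ z⟩ :
        ProbabilityMeasure (RefMem Xh Uh X Q))) = G :=
      funext fun z => Subtype.ext (hG' z).symm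
    rw [h]
    exact hG
  out := fun c => sim.interface c.1
  univMeasurable_out := sim.univMeasurable_interface.comp_measurable measurable_fst

end Refinement

/-! ### Integration of universally measurable functions -/

/-! Two independent facts are combined: the refined strategy reaches an accepting location at least
as often as the robust value of `μ` predicts, and that value is already the optimal one.

For the first, the memory of the refined strategy carries an abstract state whose conditional law
given the concrete history comes from disintegrating the lifted kernel. Averaging the abstract value
over this law, and counting it as zero off the relation, gives a lower bound for the concrete
reachability probability (`lintegral_robust_le_reachWithin`). The bound survives one more step of
the induction because on the relation the outputs, hence the labels, agree, while the coupling
leaves the relation with mass at most `δ`, which is exactly what the robust operator subtracts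
(`lintegral_prodDFA_trans_le_next`). Reachability within `l` steps is at most the probability of
ever visiting (`IsChainLaw.reachWithin_le`), and such a visit means that a prefix of the word is
accepted (`exists_mem_refTarget_le_sat`).

For the second, the optimal value `V` satisfies `V ≤ T* V`, and `T* V` equals `T^μ V` because `μ`
attains the supremum. If `δ > 0`, a subsolution of `T^μ` lies below the limit of the iterates from
`0`: every step costs `δ` while values stay below `1`, so value cannot be sustained by postponing
acceptance. If `δ = 0` postponement is free, this comparison fails, and equality of the values is a
hypothesis.

Kernels are only universally measurable, so Borel versions are chosen relative to the measures that
actually occur. On the abstract side `∫⁻` is used as a lower integral: inequalities in the required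
direction hold for arbitrary integrands. -/

theorem UnivMeasurable.lintegral {Z W : Type*} [MeasurableSpace Z] [MeasurableSpace W]
    {G : Z → ProbabilityMeasure W} (hG : UnivMeasurable G) {f : W → ℝ≥0∞}
    (hf : UnivMeasurable f) : UnivMeasurable fun z => ∫⁻ w, f w ∂(G z : Measure W) := by
  intro ν hν
  have hGν := hG ν hν
  let κ : Kernel Z W := ⟨fun z => ((hGν.mk G z : ProbabilityMeasure W) : Measure W),
    measurable_subtype_coe.comp hGν.measurable_mk⟩
  have : IsMarkovKernel κ := ⟨fun z => (hGν.mk G z).2⟩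
  -- The Borel version of `f` is chosen for the mixture of the laws, so that for `ν`-almost every
  -- `z` it agrees with `f` almost everywhere under `κ z`.
  have hfρ := hf (ν.bind κ) inferInstance
  refine ⟨fun z => ∫⁻ w, hfρ.mk f w ∂κ z, hfρ.measurable_mk.lintegral_kernel, ?_⟩
  filter_upwards [hGν.ae_eq_mk, Measure.ae_ae_of_ae_bind κ.measurable.aemeasurable hfρ.ae_eq_mk]
    with z hz hz'
  have : (G z : Measure W) = κ z := congrArg Subtype.val hz
  rw [this]
  exact lintegral_congr_ae hz'

/-- A lower integral is attained by a measurable minorant, to which Tonelli applies; this half needs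
no measurability of `f`. -/
theorem lintegral_compProd_le {Z W : Type*} [MeasurableSpace Z] [MeasurableSpace W]
    (ν : Measure Z) [SFinite ν] (κ : Kernel Z W) [IsSFiniteKernel κ] (f : Z × W → ℝ≥0∞) :
    ∫⁻ p, f p ∂(ν ⊗ₘ κ) ≤ ∫⁻ z, ∫⁻ w, f (z, w) ∂κ z ∂ν := by
  obtain ⟨g, hg, hgf, h⟩ := exists_measurable_le_lintegral_eq (μ := ν ⊗ₘ κ) f
  rw [h, Measure.lintegral_compProd hg]
  exact lintegral_mono fun z => lintegral_mono fun w => hgf _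

/-! ### Reachability within finitely many steps -/

/-- The probability that a Markov process with one-step laws `K` visits `T` within `l` steps. -/
noncomputable def reachWithin {Z : Type*} [MeasurableSpace Z] (K : Z → Measure Z) (T : Set Z) :
    ℕ → Z → ℝ≥0∞
  | 0, z => T.indicator 1 z
  | l + 1, z => max (T.indicator 1 z) (∫⁻ z', reachWithin K T l z' ∂K z)

theorem indicator_le_reachWithin {Z : Type*} [MeasurableSpace Z] (K : Z → Measure Z) (T : Set Z)
    (l : ℕ) (z : Z) : T.indicator 1 z ≤ reachWithin K T l z := by
  cases l with
  | zero => exact le_rfl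
  | succ l => exact le_max_left _ _

theorem reachWithin_le_one {Z : Type*} [MeasurableSpace Z] {K : Z → Measure Z}
    (hK : ∀ z, IsProbabilityMeasure (K z)) (T : Set Z) (l : ℕ) (z : Z) :
    reachWithin K T l z ≤ 1 := by
  have hT : ∀ z, T.indicator (1 : Z → ℝ≥0∞) z ≤ 1 := Set.indicator_le_self' (fun _ _ => zero_le)
  induction l generalizing z with
  | zero => exact hT z
  | succ l ih =>
    refine max_le (hT z) ((lintegral_mono ih).trans ?_)
    simp

theorem univMeasurable_reachWithin {Z : Type*} [MeasurableSpace Z] {K : Z → Measure Z}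
    (hK : ∃ G : Z → ProbabilityMeasure Z, UnivMeasurable G ∧ ∀ z, (G z : Measure Z) = K z)
    {T : Set Z} (hT : MeasurableSet T) (l : ℕ) : UnivMeasurable (reachWithin K T l) := by
  obtain ⟨G, hG, hG'⟩ := hK
  have h1 : Measurable (T.indicator (1 : Z → ℝ≥0∞)) := measurable_one.indicator hT
  induction l with
  | zero => exact UnivMeasurable.of_measurable h1
  | succ l ih =>
    intro ν hν
    have := (hG.lintegral ih) ν hν
    simp only [hG'] at this
    exact h1.aemeasurable.sup this

/-! ### Laws of Markov chains with universally measurable kernels -/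

/-- `P` is the law of the Markov chain with one-step laws `K` started at `z₀`. -/
structure IsChainLaw {Z : Type*} [MeasurableSpace Z] (K : Z → Measure Z) (z₀ : Z)
    (P : Measure (ℕ → Z)) : Prop where
  prob : IsProbabilityMeasure P
  init : P.map (fun ω => ω 0) = Measure.dirac z₀
  step : ∀ (n : ℕ) (A : Set (Finset.Iic n → Z)) (B : Set Z), MeasurableSet A → MeasurableSet B →
    P {ω | Preorder.frestrictLe n ω ∈ A ∧ ω (n + 1) ∈ B} =
      ∫⁻ ω in {ω | Preorder.frestrictLe n ω ∈ A}, K (ω n) B ∂P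

section Chain

variable {Z : Type*} [MeasurableSpace Z] {K : Z → Measure Z} {z₀ : Z} {P : Measure (ℕ → Z)}

/-- Restricted to an event of the past, the law of the next state is the mixture of the one-step
laws. Equality of these two measures lets sets be replaced by universally measurable functions. -/
theorem IsChainLaw.setLIntegral_succ
    (hK : ∃ G : Z → ProbabilityMeasure Z, UnivMeasurable G ∧ ∀ z, (G z : Measure Z) = K z)
    (h : IsChainLaw K z₀ P) (n : ℕ)
    {A : Set (Finset.Iic n → Z)} (hA : MeasurableSet A) {f : Z → ℝ≥0∞}
    (hf : UnivMeasurable f) :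
    ∫⁻ ω in {ω | Preorder.frestrictLe n ω ∈ A}, f (ω (n + 1)) ∂P =
      ∫⁻ ω in {ω | Preorder.frestrictLe n ω ∈ A}, ∫⁻ z, f z ∂(K (ω n)) ∂P := by
  have := h.prob
  have hKae : ∀ ν : Measure Z, IsFiniteMeasure ν → AEMeasurable K ν := fun ν hν => by
    obtain ⟨G, hG, hG'⟩ := hK
    obtain rfl : (fun z => (G z : Measure Z)) = K := funext hG'
    exact measurable_subtype_coe.comp_aemeasurable (hG ν hν)
  set S : Set (ℕ → Z) := {ω | Preorder.frestrictLe n ω ∈ A}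
  have hst : AEMeasurable (fun ω => K (ω n)) (P.restrict S) :=
    AEMeasurable.comp_measurable (f := fun ω : ℕ → Z => ω n)
      (hKae ((P.restrict S).map fun ω => ω n) inferInstance) (measurable_pi_apply n)
  have key : (P.restrict S).map (fun ω => ω (n + 1)) =
      (P.restrict S).bind fun ω => K (ω n) := by
    ext B hB
    rw [Measure.bind_apply hB hst, Measure.map_apply (measurable_pi_apply _) hB,
      Measure.restrict_apply (measurable_pi_apply _ hB), ← h.step n A B hA hB, Set.inter_comm]
    rfl
  have hfin : IsFiniteMeasure ((P.restrict S).map (fun ω => ω (n + 1))) := inferInstance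
  have hfm := hf _ hfin
  rw [← lintegral_map' hfm (measurable_pi_apply _).aemeasurable, key, Measure.lintegral_bind hst (key ▸ hfm)]

theorem IsChainLaw.ae_zero [MeasurableSingletonClass Z] (h : IsChainLaw K z₀ P) :
    ∀ᵐ ω ∂P, ω 0 = z₀ := by
  have h0 : ∀ᵐ z ∂(P.map fun ω => ω 0), z = z₀ := by
    rw [h.init, ae_dirac_eq]; rfl
  exact ae_of_ae_map (measurable_pi_apply 0).aemeasurable h0

/-- The Markov property is applied on the events `E n` that no visit has occurred up to time `n`.
Splitting by whether time `n + 1` is a visit turns the recursion for `reachWithin` into disjoint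
parts of the hitting event. -/
theorem IsChainLaw.reachWithin_le [MeasurableSingletonClass Z]
    (hK : ∃ G : Z → ProbabilityMeasure Z, UnivMeasurable G ∧ ∀ z, (G z : Measure Z) = K z)
    (h : IsChainLaw K z₀ P) {T : Set Z} (hT : MeasurableSet T) (l : ℕ) :
    reachWithin K T l z₀ ≤ P {ω | ∃ t, ω t ∈ T} := by
  have := h.prob
  have hKp : ∀ z, IsProbabilityMeasure (K z) := fun z => by
    obtain ⟨G, -, hG⟩ := hK
    exact hG z ▸ (G z).2
  let R := reachWithin K T
  let E : ℕ → Set (ℕ → Z) := fun n =>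
    {ω : ℕ → Z | Preorder.frestrictLe (π := fun _ => Z) n ω ∈ {y : Finset.Iic n → Z | ∀ i, y i ∉ T}}
  have hA : ∀ n : ℕ, MeasurableSet {y : Finset.Iic n → Z | ∀ i, y i ∉ T} := by
    intro n
    simp only [Set.ofPred_forall]
    exact MeasurableSet.iInter fun i => (measurable_pi_apply i hT).compl
  have hE : ∀ n, MeasurableSet (E n) := fun n =>
    (Preorder.measurable_frestrictLe (X := fun _ => Z) n) (hA n)
  have hEmem : ∀ n ω, ω ∈ E n ↔ ∀ t ≤ n, ω t ∉ T := fun n ω =>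
    ⟨fun hω t ht => hω ⟨t, Finset.mem_Iic.2 ht⟩, fun hω i => hω i (Finset.mem_Iic.1 i.2)⟩
  let H : Set (ℕ → Z) := {ω | ∃ t, ω t ∈ T}
  have hTn : ∀ n, MeasurableSet {ω : ℕ → Z | ω n ∈ T} := fun n => measurable_pi_apply n hT
  have hR1 : ∀ l z, R l z ≤ 1 := reachWithin_le_one hKp T
  -- The time `n` stays general because the induction on the horizon `l` moves it forward by one.
  have main : ∀ l n, ∫⁻ ω in E n, ∫⁻ z, R l z ∂(K (ω n)) ∂P ≤ P (E n ∩ H) := by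
    intro l
    induction l with
    | zero =>
      intro n
      rw [← h.setLIntegral_succ hK n (hA n) (univMeasurable_reachWithin hK hT 0)]
      change ∫⁻ ω in E n, T.indicator 1 (ω (n + 1)) ∂P ≤ _
      have : ∀ ω : ℕ → Z, T.indicator (1 : Z → ℝ≥0∞) (ω (n + 1)) =
          {ω : ℕ → Z | ω (n + 1) ∈ T}.indicator 1 ω := fun ω => rfl
      simp only [this]
      rw [lintegral_indicator_one (hTn _), Measure.restrict_apply (hTn _)]
      exact measure_mono fun ω hω => ⟨hω.2, n + 1, hω.1⟩
    | succ l ih =>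
      intro n
      rw [← h.setLIntegral_succ hK n (hA n)
        (univMeasurable_reachWithin hK hT (l + 1))]
      change ∫⁻ ω in E n, R (l + 1) (ω (n + 1)) ∂P ≤ _
      have hsub : E (n + 1) = E n \ {ω | ω (n + 1) ∈ T} := by
        ext ω
        simp only [Set.mem_sdiff, hEmem, Set.mem_ofPred_eq]
        refine ⟨fun hω => ⟨fun t ht => hω t (by omega), hω _ le_rfl⟩, fun hω t ht => ?_⟩
        rcases Nat.lt_or_ge n t with h' | h'
        · obtain rfl : t = n + 1 := by omega
          exact hω.2
        · exact hω.1 t h'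
      rw [← lintegral_inter_add_sdiff _ _ (hTn (n + 1)), ← hsub]
      have e1 : ∫⁻ ω in E n ∩ {ω | ω (n + 1) ∈ T}, R (l + 1) (ω (n + 1)) ∂P ≤
          P (E n ∩ {ω | ω (n + 1) ∈ T}) := by
        refine (lintegral_mono fun ω => hR1 _ _).trans ?_
        simp
      have e2 : ∫⁻ ω in E (n + 1), R (l + 1) (ω (n + 1)) ∂P ≤ P (E (n + 1) ∩ H) := by
        -- Without a visit at time `n + 1` the indicator vanishes, so `R (l + 1)` is at most its
        -- integral term.
        refine le_trans (setLIntegral_mono' (hE _) fun ω hω => ?_) (ih (n + 1))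
        have : ω (n + 1) ∉ T := (hEmem _ _).1 hω _ le_rfl
        change max _ _ ≤ _
        rw [Set.indicator_of_notMem this]
        exact max_le zero_le le_rfl
      refine (add_le_add e1 e2).trans ?_
      rw [← measure_union _ ((hE _).inter _)]
      · refine measure_mono ?_
        rintro ω (hω | hω)
        · exact ⟨hω.1, n + 1, hω.2⟩
        · exact ⟨(hsub ▸ hω.1).1, hω.2⟩
      · rw [hsub]
        exact Set.disjoint_left.2 fun ω hω hω' => hω'.1.2 hω.2
      · change MeasurableSet {ω : ℕ → Z | ∃ t, ω t ∈ T}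
        rw [Set.ofPred_exists]
        exact MeasurableSet.iUnion hTn
  -- A visit at time `0` is separate, since `E 0` already excludes it; otherwise `E 0` has full
  -- measure.
  by_cases h0 : z₀ ∈ T
  · refine (hR1 l _).trans ?_
    rw [← measure_univ (μ := P)]
    refine measure_mono_ae ?_
    filter_upwards [h.ae_zero] with ω hω _
    exact ⟨0, hω ▸ h0⟩
  · cases l with
    | zero => simp [reachWithin, h0]
    | succ l =>
      simp only [reachWithin, Set.indicator_of_notMem h0]
      refine max_le zero_le ?_
      calc ∫⁻ z, R l z ∂(K z₀)
          = ∫⁻ _, ∫⁻ z, R l z ∂(K z₀) ∂P := by simp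
        _ = ∫⁻ ω in E 0, ∫⁻ z, R l z ∂(K (ω 0)) ∂P := by
          have hE0 : P.restrict (E 0) = P := by
            refine Measure.restrict_eq_self_of_ae_mem ?_
            filter_upwards [h.ae_zero] with ω hω
            refine (hEmem _ _).2 fun t ht => ?_
            rw [Nat.le_zero.1 ht, hω]
            exact h0
          rw [hE0]
          refine lintegral_congr_ae ?_
          filter_upwards [h.ae_zero] with ω hω
          rw [hω]
        _ ≤ P (E 0 ∩ H) := main l 0
        _ ≤ P H := measure_mono Set.inter_subset_right

/-! ### Existence of the chain law by the Ionescu-Tulcea construction -/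

/-- The marginals `ρ n` can be computed from the universally measurable kernel before any path
measure exists. A Borel version chosen for each `ρ n` yields a time-dependent chain with these same
marginals, so replacing each version by `K` changes nothing almost surely. -/
theorem exists_isChainLaw
    (hK : ∃ G : Z → ProbabilityMeasure Z, UnivMeasurable G ∧ ∀ z, (G z : Measure Z) = K z)
    (z₀ : Z) : ∃ P, IsChainLaw K z₀ P := by
  obtain ⟨G, hG, hG'⟩ := hK
  have hGν : ∀ ν : Measure Z, IsFiniteMeasure ν →
      AEMeasurable (fun z => (G z : Measure Z)) ν := fun ν hν =>
    measurable_subtype_coe.comp_aemeasurable (hG ν hν)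
  obtain ⟨ρ, hρ0, hρs⟩ : ∃ ρ : ℕ → Measure Z, ρ 0 = Measure.dirac z₀ ∧
      ∀ n, ρ (n + 1) = (ρ n).bind fun z => (G z : Measure Z) :=
    ⟨fun n => n.rec (Measure.dirac z₀) fun _ r => r.bind fun z => (G z : Measure Z),
      rfl, fun _ => rfl⟩
  have hρ : ∀ n, IsProbabilityMeasure (ρ n) := by
    intro n
    induction n with
    | zero => rw [hρ0]; infer_instance
    | succ n ih =>
      constructor
      rw [hρs, Measure.bind_apply MeasurableSet.univ (hGν (ρ n) inferInstance)]
      simp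
  have hGρ : ∀ n : ℕ, AEMeasurable G (ρ n) := fun n => hG _ inferInstance
  let k : ℕ → Kernel Z Z := fun n =>
    ⟨fun z => (((hGρ n).mk G z : ProbabilityMeasure Z) : Measure Z),
      measurable_subtype_coe.comp (hGρ n).measurable_mk⟩
  have hk : ∀ n, IsMarkovKernel (k n) := fun n => ⟨fun z => ((hGρ n).mk G z).2⟩
  have hkG : ∀ n : ℕ, ∀ᵐ z ∂(ρ n), K z = k n z := fun n => by
    filter_upwards [(hGρ n).ae_eq_mk] with z hz
    rw [← hG']
    exact congrArg Subtype.val hz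
  let κ : (n : ℕ) → Kernel (Finset.Iic n → Z) Z := fun n =>
    (k n).comap (fun y => y ⟨n, Finset.mem_Iic.2 le_rfl⟩) (by fun_prop)
  have hκ : ∀ n, IsMarkovKernel (κ n) := fun n => inferInstance
  let P : Measure (ℕ → Z) :=
    Kernel.trajMeasure (X := fun _ => Z) (Measure.dirac z₀) κ
  have hprob : IsProbabilityMeasure P := by
    change IsProbabilityMeasure (Kernel.trajMeasure _ _)
    infer_instance
  have hinit : P.map (fun ω => ω 0) = Measure.dirac z₀ := by
    have e : P.map (Preorder.frestrictLe 0) = (Measure.dirac z₀).map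
        (MeasurableEquiv.piUnique (fun _ : Finset.Iic 0 => Z)).symm := by
      change (Kernel.trajMeasure _ _).map _ = _
      rw [Kernel.trajMeasure, Measure.map_comp _ _ (by fun_prop), Kernel.traj_map_frestrictLe,
        Kernel.partialTraj_self, Measure.id_comp]
    have hc : (fun ω : ℕ → Z => ω 0) =
        (fun y : Finset.Iic 0 → Z => y ⟨0, Finset.mem_Iic.2 le_rfl⟩) ∘
          Preorder.frestrictLe 0 := rfl
    have hm : Measurable fun y : Finset.Iic 0 → Z => y ⟨0, Finset.mem_Iic.2 le_rfl⟩ :=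
      measurable_pi_apply _
    rw [hc, ← Measure.map_map hm (Preorder.measurable_frestrictLe 0), e,
      Measure.map_map hm (MeasurableEquiv.measurable _)]
    exact Measure.map_id
  have hjoint : ∀ n, P.map (Preorder.frestrictLe n) ⊗ₘ κ n =
      P.map (fun ω => (Preorder.frestrictLe n ω, ω (n + 1))) := fun n =>
    Kernel.map_frestrictLe_trajMeasure_compProd_eq_map_trajMeasure
  have hstep : ∀ (n : ℕ) (A : Set (Finset.Iic n → Z)) (B : Set Z),
      MeasurableSet A → MeasurableSet B → P {ω | Preorder.frestrictLe n ω ∈ A ∧ ω (n + 1) ∈ B} =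
        ∫⁻ ω in {ω | Preorder.frestrictLe n ω ∈ A}, k n (ω n) B ∂P := by
    intro n A B hA hB
    have hm : Measurable (Preorder.frestrictLe n : (ℕ → Z) → _) :=
      Preorder.measurable_frestrictLe n
    have e := congrArg (fun m => m (A ×ˢ B)) (hjoint n)
    rw [Measure.compProd_apply_prod hA hB, Measure.restrict_map hm hA,
      lintegral_map (Kernel.measurable_coe _ hB) hm, Measure.map_apply (by fun_prop) (hA.prod hB)]
      at e
    exact e.symm
  have hmarg : ∀ n, P.map (fun ω => ω n) = ρ n := by
    intro n
    induction n with
    | zero => exact hinit.trans hρ0.symm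
    | succ n ih =>
      ext B hB
      have e := hstep n Set.univ B MeasurableSet.univ hB
      simp only [Set.mem_univ, true_and, Set.ofPred_true, Measure.restrict_univ] at e
      rw [Measure.map_apply (measurable_pi_apply _) hB]
      refine e.trans ?_
      rw [hρs, Measure.bind_apply hB (hGν (ρ n) inferInstance), ←
        lintegral_map (f := fun z => k n z B) (Kernel.measurable_coe _ hB) (measurable_pi_apply n), ih]
      refine lintegral_congr_ae ?_
      filter_upwards [hkG n] with z hz
      rw [hG', hz]
  refine ⟨P, hprob, hinit, fun n A B hA hB => (hstep n A B hA hB).trans ?_⟩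
  -- The exceptional set is null for `ρ n`, which is now known to be the `n`-th marginal of `P`.
  have hkG' : ∀ᵐ ω ∂P, K (ω n) = k n (ω n) :=
    ae_of_ae_map (f := fun ω : ℕ → Z => ω n) (p := fun z => K z = k n z)
      (measurable_pi_apply n).aemeasurable ((hmarg n).symm ▸ hkG n)
  refine lintegral_congr_ae (ae_restrict_of_ae ?_)
  filter_upwards [hkG'] with ω hω
  rw [hω]

end Chain

/-! ### One step of a controlled Markov decision process -/

section Execution

variable {X U Y : Type*} [MeasurableSpace X] [MeasurableSpace U] [MeasurableSpace Y]

instance (M : GMDP X U Y) (x : X) (ν : ProbabilityMeasure U) :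
    IsProbabilityMeasure (M.next x ν) := by
  obtain ⟨G, -, hG⟩ := UnivMeasurable.next M (ν := fun _ : Unit => ν) (x := fun _ => x)
    (UnivMeasurable.of_measurable measurable_const) measurable_const
  exact hG () ▸ (G ()).2

instance (M : GMDP X U Y) (C : ControlStrategy X U) (z : X × C.Mem) :
    IsProbabilityMeasure (stepLaw M C z) := by
  obtain ⟨G, -, hG⟩ := exists_stepLaw M C
  exact hG z ▸ (G z).2

theorem univMeasurable_lintegral_next (M : GMDP X U Y) (C : ControlStrategy X U) (x : X)
    {f : X × C.Mem → ℝ≥0∞} (hf : UnivMeasurable f) :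
    UnivMeasurable fun c => ∫⁻ x', f (x', c) ∂(M.next x (C.out c)) := by
  obtain ⟨G₁, hG₁, hG₁'⟩ := UnivMeasurable.next M C.univMeasurable_out
    (x := fun _ => x) measurable_const
  obtain ⟨G₂, hG₂, hG₂'⟩ := hG₁.map (f := fun y : C.Mem × X => (y.2, y.1)) (by fun_prop)
  have h := hG₂.lintegral hf
  have h' : ∀ c, ∫⁻ w, f w ∂(G₂ c : Measure (X × C.Mem)) =
      ∫⁻ x', f (x', c) ∂(M.next x (C.out c)) := by
    intro c
    rw [hG₂', hG₁', lintegral_map' (hf _ inferInstance) (by fun_prop)]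
  simpa only [h'] using h

theorem lintegral_stepLaw (M : GMDP X U Y) (C : ControlStrategy X U)
    {f : X × C.Mem → ℝ≥0∞} (hf : UnivMeasurable f) (z : X × C.Mem) :
    ∫⁻ w, f w ∂(stepLaw M C z) =
      ∫⁻ c, ∫⁻ x', f (x', c) ∂(M.next z.1 (C.out c)) ∂(C.trans (z.2, z.1) : Measure C.Mem) := by
  obtain ⟨G₁, hG₁, hG₁'⟩ := UnivMeasurable.next M C.univMeasurable_out
    (x := fun _ => z.1) measurable_const
  obtain ⟨G₂, hG₂, hG₂'⟩ := hG₁.map (f := fun y : C.Mem × X => (y.2, y.1)) (by fun_prop)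
  have hae : AEMeasurable (fun c => (M.next z.1 (C.out c)).map fun x' => (x', c))
      (C.trans (z.2, z.1) : Measure C.Mem) := by
    have := measurable_subtype_coe.comp_aemeasurable (hG₂ (C.trans (z.2, z.1)) inferInstance)
    refine this.congr (Eventually.of_forall fun c => ?_)
    exact (hG₂' c).trans (congrArg _ (hG₁' c))
  have hfin : IsFiniteMeasure (stepLaw M C z) := inferInstance
  rw [stepLaw, Measure.lintegral_bind hae (hf _ hfin)]
  refine lintegral_congr fun c => ?_
  rw [lintegral_map' (hf _ inferInstance) (by fun_prop)]

end Execution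

/-! ### Comparison of the optimal value with the value of an optimal policy -/

theorem max_indicator_le_one {S Q : Type*} {F : Set Q} {z : S × Q} {v : ℝ≥0∞} (hv : v ≤ 1) :
    max (F.indicator 1 z.2) v ≤ 1 :=
  max_le (Set.indicator_le_self' (fun _ _ => zero_le) _) hv

section Values

variable {S U Y Q : Type*} [MeasurableSpace S] [MeasurableSpace Q] [MeasurableSpace U]
  [MeasurableSpace Y]

theorem robust_le_one (N : GMDP (S × Q) U Y) (F : Set Q) (δ : ℝ≥0) (μ : Policy (S × Q) U)
    (V : S × Q → ℝ≥0∞) (z : S × Q) : robust N F δ μ V z ≤ 1 :=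
  min_le_left _ _

theorem robust_iterate_le_one (N : GMDP (S × Q) U Y) (F : Set Q) (δ : ℝ≥0)
    (μ : Policy (S × Q) U) (l : ℕ) (z : S × Q) : (robust N F δ μ)^[l] 0 z ≤ 1 := by
  cases l with
  | zero => exact zero_le
  | succ l => rw [Function.iterate_succ_apply']; exact robust_le_one ..

theorem robustValue_le_one (N : GMDP (S × Q) U Y) (F : Set Q) (δ : ℝ≥0) (μ : Policy (S × Q) U)
    (z : S × Q) : robustValue N F δ μ z ≤ 1 :=
  iSup_le fun l => robust_iterate_le_one N F δ μ l z

/-- Only monotonicity is needed for this half of the fixed-point equation; the other half, which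
would need continuity along the iterates, plays no role. -/
theorem optRobustValue_le_optRobust (N : GMDP (S × Q) U Y) (F : Set Q) (δ : ℝ≥0) :
    optRobustValue N F δ ≤ optRobust N F δ (optRobustValue N F δ) := by
  intro z
  refine iSup_le fun l => ?_
  cases l with
  | zero => exact zero_le
  | succ l =>
    rw [Function.iterate_succ_apply']
    exact optRobust_mono N F δ (fun z' => le_iSup (fun l => (optRobust N F δ)^[l] 0 z') l) z

theorem bellman_le_one (N : GMDP (S × Q) U Y) (F : Set Q) (μ : Policy (S × Q) U)
    {V : S × Q → ℝ≥0∞} (hV : ∀ z, V z ≤ 1) (z : S × Q) : bellman N F μ V z ≤ 1 := by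
  refine (lintegral_mono fun z' => max_indicator_le_one (hV z')).trans ?_
  simp

/-- A quantitative comparison: rearranged, `n δ (V - W_n) ≤ 1 - V`, where `W_n` is the `n`-th
iterate from `0`. The coefficients are chosen so that both sides agree when `V` and `W_n` are
replaced by `1`, which makes accepting locations harmless. -/
theorem mul_subsolution_le (N : GMDP (S × Q) U Y) (F : Set Q) (δ : ℝ≥0) (μ : Policy (S × Q) U)
    {V : S × Q → ℝ≥0∞} (hV : V ≤ robust N F δ μ V) (n : ℕ) (z : S × Q) :
    ((n : ℝ≥0∞) * δ + 1) * V z ≤ 1 + n * δ * (robust N F δ μ)^[n] 0 z := by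
  have hV1 : ∀ z, V z ≤ 1 := fun z => (hV z).trans (robust_le_one ..)
  induction n generalizing z with
  | zero => simpa using hV1 z
  | succ n ih =>
    rw [Function.iterate_succ_apply']
    set W := (robust N F δ μ)^[n] 0
    have hW1 : ∀ z, W z ≤ 1 := robust_iterate_le_one N F δ μ n
    have hab : ((n : ℝ≥0∞) * δ + 1) * bellman N F μ V z ≤ 1 + n * δ * bellman N F μ W z := by
      have hc : (n : ℝ≥0∞) * δ ≠ ∞ := ENNReal.mul_ne_top (ENNReal.natCast_ne_top n) ENNReal.coe_ne_top
      have hc' : (n : ℝ≥0∞) * δ + 1 ≠ ∞ := ENNReal.add_ne_top.2 ⟨hc, ENNReal.one_ne_top⟩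
      -- Only finite constants are moved through the integral, so `V` need not be measurable.
      calc ((n : ℝ≥0∞) * δ + 1) * bellman N F μ V z
          = ∫⁻ z', ((n : ℝ≥0∞) * δ + 1) * max (F.indicator 1 z'.2) (V z')
              ∂(N.next z (μ.toFun z)) := (lintegral_const_mul' _ _ hc').symm
        _ ≤ ∫⁻ z', 1 + (n : ℝ≥0∞) * δ * max (F.indicator 1 z'.2) (W z')
              ∂(N.next z (μ.toFun z)) := by
            refine lintegral_mono fun z' => ?_
            by_cases hz : z'.2 ∈ F
            · simp [hz, hV1 z', hW1 z', add_comm]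
            · simpa [hz] using ih z'
        _ = 1 + n * δ * bellman N F μ W z := by
            rw [lintegral_add_left measurable_const, lintegral_const_mul' _ _ hc]
            simp [bellman]
    have ha1 := bellman_le_one N F μ hV1 z
    have hb1 := bellman_le_one N F μ hW1 z
    have hv : V z ≤ bellman N F μ V z - δ := (hV z).trans (min_le_right _ _)
    have hr : robust N F δ μ W z = bellman N F μ W z - δ :=
      min_eq_right (tsub_le_self.trans hb1)
    rw [hr]
    -- Where `V` is positive the truncation at `0` is inactive, which gives the true drift `V + δ ≤
    -- T^μ V`.
    rcases eq_or_ne (V z) 0 with h0 | h0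
    · simp [h0]
    have hva : V z + δ ≤ bellman N F μ V z := by
      have hδ : (δ : ℝ≥0∞) ≤ bellman N F μ V z := by
        by_contra h
        rw [tsub_eq_zero_of_le (not_le.1 h).le] at hv
        exact h0 (le_zero_iff.1 hv)
      calc V z + δ ≤ bellman N F μ V z - δ + δ := by gcongr
        _ = _ := tsub_add_cancel_of_le hδ
    have hvt := ((hV1 z).trans_lt ENNReal.one_lt_top).ne
    generalize bellman N F μ V z = a at *
    generalize bellman N F μ W z = b at *
    generalize V z = v at *
    lift a to ℝ≥0 using (ha1.trans_lt ENNReal.one_lt_top).ne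
    lift b to ℝ≥0 using (hb1.trans_lt ENNReal.one_lt_top).ne
    lift v to ℝ≥0 using hvt
    norm_cast at hab ha1 hb1 hva ⊢
    have hab' : ((n : ℝ) * δ + 1) * a ≤ 1 + n * δ * b := by exact_mod_cast hab
    have hva' : (v : ℝ) + δ ≤ a := by exact_mod_cast hva
    have ha' : (a : ℝ) ≤ 1 := by exact_mod_cast ha1
    have hb0 : (0 : ℝ) ≤ b := b.2
    have hd0 : (0 : ℝ) ≤ δ := δ.2
    have hn0 : (0 : ℝ) ≤ n := n.cast_nonneg
    have hs : (b : ℝ) - δ ≤ ((b - δ : ℝ≥0) : ℝ) := by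
      rw [NNReal.coe_sub_def]; exact le_max_left _ _
    have hs0 : (0 : ℝ) ≤ ((b - δ : ℝ≥0) : ℝ) := NNReal.coe_nonneg _
    -- With `a ≤ 1` and the bound on `(n δ + 1) a`, the product `((n + 1) δ + 1)(a - δ)` is at most
    -- `1 + n δ (b - δ) - δ²`.
    have goal : (((n : ℝ) + 1) * δ + 1) * v ≤ 1 + (n + 1) * δ * ((b - δ : ℝ≥0) : ℝ) := by
      have h1 : (((n : ℝ) + 1) * δ + 1) * v ≤ (((n : ℝ) + 1) * δ + 1) * (a - δ) :=
        mul_le_mul_of_nonneg_left (by linarith) (by positivity)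
      have h2 : (δ : ℝ) * a ≤ δ := mul_le_of_le_one_right hd0 ha'
      have h3 : (n : ℝ) * δ * (b - δ) ≤ n * δ * ((b - δ : ℝ≥0) : ℝ) :=
        mul_le_mul_of_nonneg_left hs (by positivity)
      have h4 : 0 ≤ (δ : ℝ) * ((b - δ : ℝ≥0) : ℝ) := mul_nonneg hd0 hs0
      nlinarith [mul_nonneg hd0 hd0]
    exact_mod_cast goal

/-- A positive gap `V - W` would satisfy `n δ (V - W) ≤ 1` for every `n`, contradicting the
Archimedean property when `δ > 0`. -/
theorem subsolution_le_robustValue (N : GMDP (S × Q) U Y) (F : Set Q) {δ : ℝ≥0} (hδ : δ ≠ 0)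
    (μ : Policy (S × Q) U) {V : S × Q → ℝ≥0∞} (hV : V ≤ robust N F δ μ V) :
    V ≤ robustValue N F δ μ := by
  intro z
  have h : ∀ n : ℕ, ((n : ℝ≥0∞) * δ + 1) * V z ≤ 1 + n * δ * robustValue N F δ μ z := fun n =>
    (mul_subsolution_le N F δ μ hV n z).trans (by
      gcongr; exact le_iSup (fun l => (robust N F δ μ)^[l] 0 z) n)
  have hw := ((robustValue_le_one N F δ μ z).trans_lt ENNReal.one_lt_top).ne
  have hv := (((hV z).trans (robust_le_one ..)).trans_lt ENNReal.one_lt_top).ne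
  generalize robustValue N F δ μ z = w at *
  generalize V z = v at *
  lift w to ℝ≥0 using hw
  lift v to ℝ≥0 using hv
  norm_cast at h ⊢
  by_contra hlt
  have hlt' : (w : ℝ) < v := 
    NNReal.coe_lt_coe.2 (ENNReal.coe_lt_coe.1 (not_le.1 hlt))
  have hd : (0 : ℝ) < δ := by exact_mod_cast pos_iff_ne_zero.2 hδ
  obtain ⟨n, hn⟩ := exists_nat_gt (1 / ((δ : ℝ) * (v - w)))
  rw [div_lt_iff₀ (mul_pos hd (sub_pos.2 hlt'))] at hn
  have hn' : ((n : ℝ) * δ + 1) * v ≤ 1 + n * δ * w := by exact_mod_cast h n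
  nlinarith [v.2]

/-- Attaining the supremum makes the optimal value a subsolution for `μ`. At `δ = 0` this is not
enough: a policy may stay for ever in a state of value `1` and still attain the supremum. -/
theorem IsArgSup.optRobustValue_le (N : GMDP (S × Q) U Y) (F : Set Q) {δ : ℝ≥0}
    {μ : Policy (S × Q) U} (hμ : IsArgSup N F δ μ)
    (hμ₀ : δ = 0 → robustValue N F δ μ = optRobustValue N F δ) :
    optRobustValue N F δ ≤ robustValue N F δ μ := by
  by_cases hδ : δ = 0
  · exact (hμ₀ hδ).ge
  · refine subsolution_le_robustValue N F hδ μ fun z => ?_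
    rw [hμ z]
    exact optRobustValue_le_optRobust N F δ z

end Values

/-! ### The coupled processes -/

section Coupling

variable {AP Xh Uh X U Y Q : Type*} [Finite AP] [Finite Q] [MeasurableSpace Q]
  [DiscreteMeasurableSpace Q] [MeasurableSpace Xh] [StandardBorelSpace Xh]
  [MeasurableSpace Uh] [MeasurableSpace X] [StandardBorelSpace X]
  [MeasurableSpace U] [MetricSpace Y] [MeasurableSpace Y]
  {Mh : GMDP Xh Uh Y} {M : GMDP X U Y} {ε δ : ℝ≥0}

theorem lintegral_prodDFA_trans_le (Mh : GMDP Xh Uh Y) {L : Y → Set AP} (hL : Measurable L)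
    (A : DFA (Set AP) Q) (xh : Xh) (q : Q) (uh : Uh) (f : Xh × Q → ℝ≥0∞) :
    ∫⁻ z, f z ∂((Mh.prodDFA L hL A).trans ((xh, q), uh)) ≤
      ∫⁻ xh', f (xh', A.step q (L (Mh.out xh'))) ∂(Mh.trans (xh, uh)) := by
  have hm : Measurable fun p : Xh × Q => (p.1, A.step p.2 (L (Mh.out p.1))) :=
    measurable_fst.prodMk (measurable_dfaUpdate Mh hL A)
  change ∫⁻ z, f z ∂(Kernel.map _ (fun p : Xh × Q => (p.1, A.step p.2 (L (Mh.out p.1)))) _) ≤ _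
  rw [Kernel.map_apply _ hm, Kernel.prod_apply, Kernel.comap_apply, Kernel.deterministic_apply,
    Measure.prod_dirac]
  exact (lintegral_map_le _ _).trans (lintegral_map_le _ _)

/-- If `f` dominates the conditional expectation of the abstract value on the relation, then one
step of the abstract model gains at most `δ` over one step of the concrete one. -/
theorem lintegral_prodDFA_trans_le_next (sim : StochSim Mh M 0 δ) {L : Y → Set AP}
    (hL : Measurable L) (A : DFA (Set AP) Q) {xh : Xh} {x : X} (hr : (xh, x) ∈ sim.rel) (q : Q)
    (uh : Uh) {g : Xh × Q → ℝ≥0∞} (hg : ∀ z, g z ≤ 1) {f : X → ℝ≥0∞}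
    (hf : ∀ x', ∫⁻ xh', sim.rel.indicator
      (fun p => g (p.1, A.step q (L (M.out p.2)))) (xh', x') ∂(sim.cond ((uh, xh, x), x')) ≤ f x') :
    ∫⁻ z, g z ∂((Mh.prodDFA L hL A).trans ((xh, q), uh)) ≤
      ∫⁻ x', f x' ∂(M.next x (sim.interface (uh, xh, x))) + δ := by
  obtain ⟨h1, h2, h3⟩ := sim.isLifting xh x hr uh
  have : Nonempty Xh := ⟨Mh.init⟩
  have hsw : IsMarkovKernel (sim.lift.map Prod.swap) := Kernel.IsMarkovKernel.map _ measurable_swap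
  set W := sim.lift (uh, xh, x)
  let F : Xh × X → ℝ≥0∞ := sim.rel.indicator fun p => g (p.1, A.step q (L (M.out p.2)))
  have e1 : Mh.trans (xh, uh) = W.map Prod.fst := by
    ext B hB
    rw [Measure.map_apply measurable_fst hB, ← h1 B hB, Set.prod_univ]
  have e2 : M.next x (sim.interface (uh, xh, x)) = W.map Prod.snd := by
    ext B hB
    rw [Measure.map_apply measurable_snd hB, ← h2 B hB, Set.univ_prod]
  -- This is the only source of the loss `δ`: off the relation the abstract integrand is bounded by
  -- `1`.
  have hcompl : W sim.relᶜ ≤ δ := by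
    rw [prob_compl_eq_one_sub sim.measurableSet_rel]
    exact (tsub_le_tsub_left h3 1).trans tsub_tsub_le
  calc ∫⁻ z, g z ∂((Mh.prodDFA L hL A).trans ((xh, q), uh))
      ≤ ∫⁻ xh', g (xh', A.step q (L (Mh.out xh'))) ∂(Mh.trans (xh, uh)) :=
        lintegral_prodDFA_trans_le Mh hL A xh q uh g
    _ ≤ ∫⁻ p, g (p.1, A.step q (L (Mh.out p.1))) ∂W := by
        rw [e1]; exact lintegral_map_le _ _
    _ = ∫⁻ p in sim.rel, g (p.1, A.step q (L (Mh.out p.1))) ∂W +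
          ∫⁻ p in sim.relᶜ, g (p.1, A.step q (L (Mh.out p.1))) ∂W :=
        (lintegral_add_compl _ sim.measurableSet_rel).symm
    _ ≤ ∫⁻ p, F p ∂W + δ := by
        refine add_le_add ?_ ?_
        · rw [lintegral_indicator sim.measurableSet_rel]
          refine setLIntegral_mono' sim.measurableSet_rel fun p hp => ?_
          have : Mh.out p.1 = M.out p.2 := dist_le_zero.1 (sim.dist_out_le p.1 p.2 hp)
          rw [this]
        · refine (lintegral_mono fun p => hg _).trans ?_
          simpa using hcompl
    _ ≤ ∫⁻ p, F p.swap ∂(W.map Prod.swap) + δ := by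
        gcongr
        have : W = (W.map Prod.swap).map Prod.swap := by
          rw [Measure.map_map measurable_swap measurable_swap]; simp
        conv_lhs => rw [this]
        exact lintegral_map_le _ _
    _ ≤ ∫⁻ x', ∫⁻ xh', F (xh', x') ∂(sim.cond ((uh, xh, x), x')) ∂(W.map Prod.snd) + δ := by
        gcongr
        -- The components are swapped because the abstract state is conditioned on the concrete one,
        -- whose law is the second marginal.
        have e3 : W.map Prod.swap = W.map Prod.snd ⊗ₘ (sim.cond.sectR (uh, xh, x)) := by
          have := DFunLike.congr_fun
            ((sim.lift.map Prod.swap).disintegrate (sim.lift.map Prod.swap).condKernel)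
            (uh, xh, x)
          rw [Kernel.compProd_apply_eq_compProd_sectR, Kernel.map_apply _ measurable_swap,
            Kernel.fst_apply, Kernel.map_apply _ measurable_swap,
            Measure.map_map measurable_fst measurable_swap] at this
          exact this.symm
        rw [e3]
        exact lintegral_compProd_le _ _ _
    _ ≤ ∫⁻ x', f x' ∂(M.next x (sim.interface (uh, xh, x))) + δ := by
        rw [e2]
        gcongr with x'
        exact hf x'

/-- The automaton location after reading the label of the observed state. -/
noncomputable def refLoc (M : GMDP X U Y) (L : Y → Set AP) (A : DFA (Set AP) Q)
    (z : RefMem Xh Uh X Q × X) : Q :=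
  A.step (if z.1.2.2 = true then z.1.2.1 else A.start) (L (M.out z.2))

theorem measurable_refLoc (M : GMDP X U Y) {L : Y → Set AP} (hL : Measurable L)
    (A : DFA (Set AP) Q) : Measurable (refLoc (Xh := Xh) (Uh := Uh) M L A) := by
  have h : Measurable fun z : RefMem Xh Uh X Q × X =>
      if z.1.2.2 = true then z.1.2.1 else A.start :=
    Measurable.ite measurableSet_started (by fun_prop) measurable_const
  exact (measurable_dfaUpdate M hL A).comp (measurable_snd.prodMk h)

/-- The law of the abstract state given the memory and the observed state. -/
noncomputable def refState (sim : StochSim Mh M ε δ) (z : RefMem Xh Uh X Q × X) : Measure Xh :=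
  if z.1.2.2 = true then sim.cond (z.1.1, z.2) else Measure.dirac Mh.init

instance (sim : StochSim Mh M ε δ) (z : RefMem Xh Uh X Q × X) :
    IsProbabilityMeasure (refState sim z) := by
  unfold refState
  split_ifs <;> infer_instance

/-- Given memory and observation, the abstract state is the only random part of the update. -/
theorem refUpdate_apply (sim : StochSim Mh M ε δ) (L : Y → Set AP) (hL : Measurable L)
    (A : DFA (Set AP) Q) (z : RefMem Xh Uh X Q × X) :
    refUpdate sim L hL A z =
      (refState sim z).map fun xh => ((xh, refLoc M L A z), z.2) := by
  have hm : Measurable fun p : Xh × Q × X =>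
      ((p.1, A.step p.2.1 (L (M.out p.2.2))), p.2.2) :=
    (measurable_fst.prodMk ((measurable_dfaUpdate M hL A).comp
      (measurable_snd.comp measurable_snd |>.prodMk (measurable_fst.comp measurable_snd)))).prodMk
      (measurable_snd.comp measurable_snd)
  rw [refUpdate, Kernel.piecewise_apply]
  by_cases hz : z.1.2.2 = true
  · have : z ∈ {z : RefMem Xh Uh X Q × X | z.1.2.2 = true} := hz
    rw [if_pos this, Kernel.map_apply _ hm, Kernel.prod_apply, Kernel.comap_apply,
      Kernel.deterministic_apply, Measure.prod_dirac, Measure.map_map hm (by fun_prop), refState,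
      if_pos hz]
    simp only [refLoc, if_pos hz]
    rfl
  · have : z ∉ {z : RefMem Xh Uh X Q × X | z.1.2.2 = true} := hz
    rw [if_neg this, Kernel.deterministic_apply, refState, if_neg hz,
      Measure.map_dirac' (by fun_prop)]
    simp only [refLoc, if_neg hz]

theorem lintegral_refTrans (sim : StochSim Mh M ε δ) (L : Y → Set AP) (hL : Measurable L)
    (A : DFA (Set AP) Q) (μ : Policy (Xh × Q) Uh) {f : RefMem Xh Uh X Q → ℝ≥0∞}
    (hf : UnivMeasurable f) (z : RefMem Xh Uh X Q × X) :
    ∫⁻ c, f c ∂(refTrans sim L hL A μ z) =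
      ∫⁻ xh, ∫⁻ uh, f ((uh, xh, z.2), refLoc M L A z, true)
        ∂(μ.toFun (xh, refLoc M L A z) : Measure Uh) ∂(refState sim z) := by
  obtain ⟨G, hG, hG'⟩ := (μ.univMeasurable.comp_measurable
    (f := fun y : (Xh × Q) × X => y.1) (by fun_prop)).map
    (f := fun y => (((y.2, y.1.1.1, y.1.2), y.1.1.2, true) : RefMem Xh Uh X Q)) (by fun_prop)
  have := isProbabilityMeasure_refTrans sim L hL A μ z
  have hfm := hf (refTrans sim L hL A μ z) inferInstance
  have hGm : AEMeasurable (fun p : (Xh × Q) × X => (G p : Measure (RefMem Xh Uh X Q)))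
      (refUpdate sim L hL A z) :=
    measurable_subtype_coe.comp_aemeasurable (hG _ inferInstance)
  have hint := hG.lintegral hf
  simp only [hG'] at hGm hint
  rw [refTrans] at hfm ⊢
  rw [Measure.lintegral_bind hGm hfm, refUpdate_apply,
    lintegral_map' (hint _ inferInstance) (by fun_prop)]
  refine lintegral_congr fun xh => ?_
  rw [lintegral_map' (hf _ inferInstance) (by fun_prop)]

/-! ### Robust iterates as lower bounds for concrete reachability -/

variable [StandardBorelSpace Uh]

/-- The states in which the refined strategy reaches an accepting location. -/
def refTarget (sim : StochSim Mh M ε δ) (L : Y → Set AP) (hL : Measurable L)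
    (A : DFA (Set AP) Q) (μ : Policy (Xh × Q) Uh) :
    Set (X × (refinedStrategy sim L hL A μ).Mem) :=
  {z | refLoc (Xh := Xh) (Uh := Uh) M L A (z.2, z.1) ∈ A.accept}

theorem measurableSet_refTarget (sim : StochSim Mh M ε δ) (L : Y → Set AP) (hL : Measurable L)
    (A : DFA (Set AP) Q) (μ : Policy (Xh × Q) Uh) :
    MeasurableSet (refTarget sim L hL A μ) :=
  ((measurable_refLoc M hL A).comp measurable_swap) (MeasurableSet.of_discrete (s := A.accept))

theorem lintegral_stepLaw_refinedStrategy (sim : StochSim Mh M ε δ) (L : Y → Set AP)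
    (hL : Measurable L) (A : DFA (Set AP) Q) (μ : Policy (Xh × Q) Uh)
    {f : X × (refinedStrategy sim L hL A μ).Mem → ℝ≥0∞} (hf : UnivMeasurable f)
    (x : X) (c : RefMem Xh Uh X Q) :
    ∫⁻ z, f z ∂(stepLaw M (refinedStrategy sim L hL A μ) (x, c)) =
      ∫⁻ xh, ∫⁻ uh, ∫⁻ x', f (x', ((uh, xh, x), refLoc M L A (c, x), true))
          ∂(M.next x (sim.interface (uh, xh, x)))
        ∂(μ.toFun (xh, refLoc M L A (c, x)) : Measure Uh) ∂(refState sim (c, x)) := by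
  rw [lintegral_stepLaw M _ hf]
  exact lintegral_refTrans sim L hL A μ
    (univMeasurable_lintegral_next M (refinedStrategy sim L hL A μ) x hf) (c, x)

/-- The memory `c` has not yet read `x`, so the abstract state paired with `x` is still random and
the value is averaged over its law. Pairs off the relation count as zero, so no claim is made once
the coupling has failed. -/
theorem lintegral_robust_le_reachWithin (sim : StochSim Mh M 0 δ) (L : Y → Set AP)
    (hL : Measurable L) (A : DFA (Set AP) Q) (μ : Policy (Xh × Q) Uh) (l : ℕ) (x : X)
    (c : RefMem Xh Uh X Q) :
    ∫⁻ xh, sim.rel.indicator (fun p => max (A.accept.indicator 1 (refLoc M L A (c, x)))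
      ((robust (Mh.prodDFA L hL A) A.accept δ μ)^[l] 0 (p.1, refLoc M L A (c, x)))) (xh, x)
        ∂(refState sim (c, x)) ≤
      reachWithin (stepLaw M (refinedStrategy sim L hL A μ)) (refTarget sim L hL A μ) l (x, c) := by
  induction l generalizing x c with
  | zero =>
    refine (lintegral_mono fun xh => Set.indicator_le_self' (fun _ _ => zero_le) _).trans ?_
    simp only [Function.iterate_zero, id, Pi.zero_apply, max_zero, lintegral_const, measure_univ,
      mul_one]
    exact le_rfl
  | succ l ih =>
    -- In an accepting location the reachability side equals `1` and dominates any value; otherwise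
    -- only the integral term matters.
    by_cases hF : refLoc M L A (c, x) ∈ A.accept
    · have h1 : (refTarget sim L hL A μ).indicator 1 (x, c) = (1 : ℝ≥0∞) :=
        Set.indicator_of_mem (s := refTarget sim L hL A μ) hF _
      refine le_trans ?_ (indicator_le_reachWithin _ _ _ _)
      rw [h1]
      refine (lintegral_mono fun xh => (Set.indicator_le_self (s := sim.rel) (f := _) _).trans
        (max_indicator_le_one (S := Xh) (z := (xh, refLoc M L A (c, x)))
          (robust_iterate_le_one _ _ _ _ (l + 1) _))).trans ?_
      simp
    · refine le_trans ?_ (le_max_right _ _)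
      rw [lintegral_stepLaw_refinedStrategy sim L hL A μ (univMeasurable_reachWithin
        (exists_stepLaw M _) (measurableSet_refTarget sim L hL A μ) l)]
      refine lintegral_mono fun xh => ?_
      by_cases hr : (xh, x) ∈ sim.rel
      swap
      · rw [Set.indicator_of_notMem hr]
        exact zero_le
      rw [Set.indicator_of_mem hr, Set.indicator_of_notMem hF, max_eq_right zero_le,
        Function.iterate_succ_apply']
      refine (min_le_right _ _).trans (tsub_le_iff_right.2 ?_)
      refine (Measure.lintegral_bind_le _ _ _).trans ?_
      -- The induction hypothesis at the updated memory is precisely the conditional bound required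
      -- here: its flag is `true`, so its abstract law is the conditional lifted kernel and its
      -- location advances by the label of `x'`.
      refine (lintegral_mono fun uh => lintegral_prodDFA_trans_le_next sim hL A hr _ uh
        (fun z => max_indicator_le_one (robust_iterate_le_one _ _ _ _ l z))
        (fun x' => ih x' ((uh, xh, x), refLoc M L A (c, x), true))).trans ?_
      rw [lintegral_add_right _ measurable_const]
      simp

/-! ### From visits of the target to accepted prefixes -/

theorem stepLaw_refinedStrategy_ne (sim : StochSim Mh M ε δ) (L : Y → Set AP)
    (hL : Measurable L) (A : DFA (Set AP) Q) (μ : Policy (Xh × Q) Uh) (x : X)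
    (c : RefMem Xh Uh X Q) :
    stepLaw M (refinedStrategy sim L hL A μ) (x, c)
      {z : X × RefMem Xh Uh X Q | z.2.2 ≠ (refLoc M L A (c, x), true)} = 0 := by
  set S : Set (X × RefMem Xh Uh X Q) := {z | z.2.2 ≠ (refLoc M L A (c, x), true)} with hS
  have hm : MeasurableSet S :=
    (measurable_snd.comp measurable_snd) (measurableSet_singleton (refLoc M L A (c, x), true)).compl
  have h := lintegral_stepLaw_refinedStrategy sim L hL A μ (f := S.indicator 1)
    (UnivMeasurable.of_measurable (measurable_one.indicator hm)) x c
  have h' : ∀ x' xh uh, S.indicator (1 : X × RefMem Xh Uh X Q → ℝ≥0∞)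
      (x', ((uh, xh, x), refLoc M L A (c, x), true)) = 0 := fun x' xh uh =>
    Set.indicator_of_notMem (by simp [hS]) _
  refine (lintegral_indicator_one hm).symm.trans (h.trans ?_)
  refine (lintegral_congr fun xh => ?_).trans lintegral_zero
  refine (lintegral_congr fun uh => ?_).trans lintegral_zero
  exact (lintegral_congr fun x' => h' x' xh uh).trans lintegral_zero

theorem ae_mem_eq_refLoc (sim : StochSim Mh M ε δ) (L : Y → Set AP) (hL : Measurable L)
    (A : DFA (Set AP) Q) (μ : Policy (Xh × Q) Uh)
    {P : Measure (ℕ → X × (refinedStrategy sim L hL A μ).Mem)}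
    (hP : IsExecutionLaw M (refinedStrategy sim L hL A μ) P) :
    ∀ᵐ ω ∂P, ∀ n, ((ω (n + 1)).2 : RefMem Xh Uh X Q).2 =
      (refLoc (Xh := Xh) (Uh := Uh) M L A ((ω n).2, (ω n).1), true) := by
  rw [ae_all_iff]
  intro n
  -- The step property tests the next state against a set that cannot depend on the past, so the
  -- location is first fixed to `q`; finiteness of `Q` then recombines the null sets.
  have key : ∀ q : Q, ∀ᵐ ω ∂P, refLoc (Xh := Xh) (Uh := Uh) M L A ((ω n).2, (ω n).1) = q →
      ((ω (n + 1)).2 : RefMem Xh Uh X Q).2 = (q, true) := by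
    intro q
    have hA' : MeasurableSet {y : Finset.Iic n → X × (refinedStrategy sim L hL A μ).Mem |
        refLoc (Xh := Xh) (Uh := Uh) M L A
          ((y ⟨n, Finset.mem_Iic.2 le_rfl⟩).2, (y ⟨n, Finset.mem_Iic.2 le_rfl⟩).1) = q} :=
      ((measurable_refLoc M hL A).comp (measurable_swap.comp (measurable_pi_apply _)))
        (measurableSet_singleton q)
    have h := hP.step n _ {z : X × RefMem Xh Uh X Q | z.2.2 ≠ (q, true)} hA'
      ((measurable_snd.comp measurable_snd) (measurableSet_singleton (q, true)).compl)
    have hz := h.trans ((setLIntegral_congr_fun (g := fun _ => 0)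
      ((Preorder.measurable_frestrictLe
        (X := fun _ => X × (refinedStrategy sim L hL A μ).Mem) n) hA') (by
        rintro ω rfl
        exact stepLaw_refinedStrategy_ne sim L hL A μ (ω n).1 (ω n).2)).trans lintegral_zero)
    rw [ae_iff]
    exact measure_mono_null (fun ω hω => Classical.not_imp.1 hω) hz
  filter_upwards [ae_all_iff.2 key] with ω hω
  exact hω _ rfl

theorem exists_mem_refTarget_le_sat (sim : StochSim Mh M ε δ) (L : Y → Set AP) (hL : Measurable L)
    (A : DFA (Set AP) Q) (μ : Policy (Xh × Q) Uh) {ψ : ScLTL AP} (hA : Recognizes A ψ)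
    {P : Measure (ℕ → X × (refinedStrategy sim L hL A μ).Mem)}
    (hP : IsExecutionLaw M (refinedStrategy sim L hL A μ) P) :
    P {ω | ∃ t, ω t ∈ refTarget sim L hL A μ} ≤ P {ω | ψ.Sat fun t => L (M.out (ω t).1)} := by
  have hinit : ∀ᵐ ω ∂P, ω 0 = (M.init, (refinedStrategy sim L hL A μ).init) :=
    IsChainLaw.ae_zero ⟨hP.prob, hP.init, hP.step⟩
  refine measure_mono_ae ?_
  filter_upwards [hinit, ae_mem_eq_refLoc sim L hL A μ hP] with ω h0 hs
  rintro ⟨t, ht⟩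
  -- The memory at time `n` has read the labels before time `n` only; `refLoc` adds the current one,
  -- whence the prefix length `n + 1`.
  have hloc : ∀ n, refLoc (Xh := Xh) (Uh := Uh) M L A ((ω n).2, (ω n).1) =
      A.eval ((List.range (n + 1)).map fun t => L (M.out (ω t).1)) := by
    intro n
    induction n with
    | zero =>
      have : refLoc (Xh := Xh) (Uh := Uh) M L A ((ω 0).2, (ω 0).1) =
          A.step A.start (L (M.out (ω 0).1)) := by
        rw [h0]; rfl
      rw [this]; rfl
    | succ n ih =>
      rw [List.range_succ, List.map_append, List.map_singleton, DFA.eval_append_singleton, ← ih]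
      simp only [refLoc, hs n, if_true]
  refine (hA _).2 ⟨t + 1, ?_⟩
  have ht' : refLoc (Xh := Xh) (Uh := Uh) M L A ((ω t).2, (ω t).1) ∈ A.accept := ht
  rw [hloc t] at ht'
  exact ht'

end Coupling

/-! ### Conclusion -/

theorem mainTheorem5 {AP Q Xh Uh X U Y : Type*} [Finite AP]
    [Finite Q] [MeasurableSpace Q] [DiscreteMeasurableSpace Q]
    [MeasurableSpace Xh] [StandardBorelSpace Xh] [MeasurableSpace Uh] [StandardBorelSpace Uh]
    [MeasurableSpace X] [StandardBorelSpace X] [MeasurableSpace U] [StandardBorelSpace U]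
    [MetricSpace Y] [MeasurableSpace Y] [BorelSpace Y]
    (Mh : GMDP Xh Uh Y) (M : GMDP X U Y) (δ : ℝ≥0) (sim : StochSim Mh M 0 δ)
    (L : Y → Set AP) (hL : Measurable L) (ψ : ScLTL AP)
    (A : DFA (Set AP) Q) (hA : Recognizes A ψ)
    (μ : Policy (Xh × Q) Uh) (hμ : IsArgSup (Mh.prodDFA L hL A) A.accept δ μ)
    (hμ₀ : δ = 0 → robustValue (Mh.prodDFA L hL A) A.accept δ μ =
      optRobustValue (Mh.prodDFA L hL A) A.accept δ) :
    SatisfiesWithProbAtLeast M (refinedStrategy sim L hL A μ) L ψ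
      (optRobustSat (Mh.prodDFA L hL A) A.accept δ) := by
  let C := refinedStrategy sim L hL A μ
  obtain ⟨P, hP⟩ := exists_isChainLaw (exists_stepLaw M C) (M.init, C.init)
  have hP' : IsExecutionLaw M C P := ⟨hP.prob, hP.init, hP.step⟩
  refine ⟨P, hP', ?_⟩
  have hout : Mh.out Mh.init = M.out M.init :=
    dist_le_zero.1 (sim.dist_out_le _ _ sim.init_mem)
  have hq : refLoc (Xh := Xh) (Uh := Uh) M L A (C.init, M.init) =
      A.step A.start (L (Mh.out Mh.init)) := by
    rw [hout]; rfl
  have hl : ∀ l, max (A.accept.indicator 1 (A.step A.start (L (Mh.out Mh.init))))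
      ((robust (Mh.prodDFA L hL A) A.accept δ μ)^[l] 0 (Mh.prodDFA L hL A).init) ≤
        P {ω | ψ.Sat fun t => L (M.out (ω t).1)} := by
    intro l
    have h := lintegral_robust_le_reachWithin sim L hL A μ l M.init C.init
    -- Before the first update the abstract state is deterministic and related to the concrete one,
    -- so the averaged bound becomes the value at the initial product state.
    have hst : refState sim (C.init, M.init) = Measure.dirac Mh.init := rfl
    rw [hst, lintegral_dirac, Set.indicator_of_mem sim.init_mem, hq] at h
    exact h.trans ((hP.reachWithin_le (exists_stepLaw M C)
      (measurableSet_refTarget sim L hL A μ) l).trans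
      (exists_mem_refTarget_le_sat sim L hL A μ hA hP'))
  refine max_le ((le_max_left _ _).trans (hl 0)) ?_
  exact (hμ.optRobustValue_le _ _ hμ₀ _).trans (iSup_le fun l => (le_max_right _ _).trans (hl l))
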